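/- **Setting.** Fix $d\in\mathbb N=\{0,1,\dots\}$, types $\mathfrak L=\{\Xi,\mathcal I\}$ (noise, kernel) and edge types $\mathcal E=\mathfrak L\times\mathbb N^d$, written $\mathfrak t_k=(\mathfrak t,k)$. Fix a scaling $\mathfrak s\in[1,\infty)^d$ and degrees $|\Xi|<0<|\mathcal I|$, and set $|k|=\sum_i k_i\mathfrak s_i$, $|\mathfrak t_k|=|\mathfrak t|-|k|$. A rule is a set $R$ of finite multisets of elements of $\mathcal E$. It is normal if $A\subset B\in R$ implies $A\in R$, and subcritical if there is $\mathrm{reg}:\mathfrak L\to\mathbb R$ with $\mathrm{reg}(\Xi)<|\Xi|$ and $\mathrm{reg}(\mathcal I)<|\mathcal I|+\inf_{N\in R}\sum_{(\mathfrak t,k)\in N}(\mathrm{reg}(\mathfrak t)-|k|)$. Let $R$ be normal and subcritical. *Trees.* $\mathfrak T^{\rm ex}$ is the set of isomorphism classes of finite rooted trees $\tau=(T,\mathfrak n,\mathfrak o,\mathfrak e)$ with $\mathfrak n:N_T\to\mathbb N^d$, $\mathfrak o:N_T\to\mathbb R$, $\mathfrak e:E_T\to\mathcal E$, in which the upper node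 of every noise edge (a noise node) is a leaf on which $\mathfrak n$ and $\mathfrak o$ vanish. $\mathcal V^{\rm ex}$ is the span of $\mathfrak T^{\rm ex}$. $\mathbf 1^a$ is the one-node tree with $\mathfrak n=0$, $\mathfrak o=a$. $\mathcal N(x)$ is the multiset of types of the edges leaving the node $x$ away from the root, and $|\tau|=\sum_{x}|\mathfrak n(x)|+\sum_{e}|\mathfrak e(e)|$. $\mathfrak T_\circ$ is the set of trees with $\mathfrak o=0$ and $\mathcal N(x)\in R$ for all nodes $x$. A tree is planted if $\mathfrak n$ vanishes at the root and exactly one edge leaves the root. $\mathfrak T_-$ is the set of $\tau\in\mathfrak T_\circ$ that are not planted, with $|\tau|<0$ and $\mathfrak n=0$ at the root. *Extraction and contraction.* Let $A\subset T$ be a subgraph, $\partial A$ the set of edges $(x,y)\notin E_A$ with $x\in N_A$ the end nearer to the root, $\mathfrak n_A:N_A\to\mathbb N^d$ with $\mathfrak n_A\le\mathfrak n$, $\mathfrak e_A:\partial A\to\mathbb N^d$, and $\pi\mathfrak e_A(x)$ the sum of $\mathfrak e_A$ over the boundary edges leaving $x$. The extracted forest $\mathscr E(\tau;A,\mathfrak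 n_A,\mathfrak e_A)$ is the multiset of connected components of $(A,\mathfrak n_A+\pi\mathfrak e_A,\mathfrak o|_{N_A},\mathfrak e|_{E_A})$. The contracted tree $\mathscr C(\tau;A,\mathfrak n_A,\mathfrak e_A)$ is obtained from $T$ by contracting each component of $A$ to a node; its edge decoration is $\mathfrak e+\mathfrak e_A$, its polynomial decoration is $\mathfrak n-\mathfrak n_A$ summed over each component, and its extended decoration at the node of a component $B$ is $\sum_{x\in N_B}(\mathfrak o(x)+|\mathfrak n_A(x)+\pi\mathfrak e_A(x)|)+\sum_{e\in E_B}|\mathfrak e(e)|$ (other decorations are unchanged). $\mathfrak T^{\rm ex}_\circ$ is the set of all $\mathscr C(\tau;A,\mathfrak n_A,\mathfrak e_A)$ with $\tau\in\mathfrak T_\circ$ such that all components of $\mathscr E(\tau;A,\mathfrak n_A,\mathfrak e_A)$ are in $\mathfrak T_-$. For $a\in\mathbb R$ let $\tilde R(a)$ be the set of the multisets $\mathcal N(\text{root of }\tau)$ over $\tau\in\mathfrak T^{\rm ex}_\circ$ whose extended decoration at the root is $a$. *Negative characters.* $\mathfrak T^{\rm ex}_-$ is the set of non-planted $\tau\in\mathfrak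 T^{\rm ex}_\circ$ with $|\tau|<0$ and $\mathfrak n=0$ at the root; $\mathcal F^{\rm ex}_-$ is the free commutative algebra generated by $\mathfrak T_-^{\rm ex}$, with basis the forests (finite multisets) of such trees; $G_-^{\rm ex}$ is the group of characters (unital algebra morphisms $\mathcal F^{\rm ex}_-\to\mathbb R$). Set $$\Delta^-_{\rm ex}\tau=\sum_{A,\mathfrak n_A,\mathfrak e_A}\frac1{\mathfrak e_A!}\binom{\mathfrak n}{\mathfrak n_A}\,\pi_-\mathscr E(\tau;A,\mathfrak n_A,\mathfrak e_A)\otimes\mathscr C(\tau;A,\mathfrak n_A,\mathfrak e_A)\in\mathcal F^{\rm ex}_-\otimes\mathcal V^{\rm ex},$$ where $\pi_-$ kills every forest not made of trees in $\mathfrak T_-^{\rm ex}$, and $M_g=(g\otimes\mathrm{id})\Delta^-_{\rm ex}$. Let $\langle\cdot,\cdot\rangle$ be the inner product on $\mathcal V^{\rm ex}$ for which distinct trees are orthogonal and $\langle\tau,\tau\rangle=\tau!$, where $\tau!=k!\prod_i\alpha_i!\prod_j(\tau_j!)^{\beta_j}\beta_j!$ if the root of $\tau$ has polynomial decoration $k$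 and carries $\alpha_i$ noise edges of each of the distinct types $\Xi_{l_i}$ and $\beta_j$ copies of each of the distinct kernel branches $\mathcal I_{m_j}[\tau_j]$. Put $M_g^*\sigma=\sum_{\tau\in\mathfrak T^{\rm ex}_\circ}\frac{\langle\sigma,M_g\tau\rangle}{\tau!}\tau$. *Non-linearities.* A non-linearity is a smooth $F:\mathbb R^{\mathcal E}\to\mathbb R$ depending on finitely many components; $D_o$ is the partial derivative in the component $o\in\mathcal E$ and $\mathcal Y_o$ the evaluation of that component. $F$ obeys $R$ if $D_{o_1}\cdots D_{o_n}F=0$ whenever the multiset $\{o_1,\dots,o_n\}$ is not in $R$. Let $\partial^iF=\sum_{p\in\mathbb N^d}\mathcal Y_{(\mathcal I,p+e_i)}D_{(\mathcal I,p)}F$, and let $\partial^k$ ($k\in\mathbb N^d$) be the composition of these commuting operators. For a family $\mathbf F=\{F_a\}_{a\le0}$ of non-linearities, only finitely many non-zero, set $F_a=0$ for $a>0$ and define $\Upsilon^{\mathbf F}$ on trees recursively by $$\Upsilon^{\mathbf F}[\tau]=\Big(\prod_{j\in J}\Upsilon^{\mathbf F}[\tau_j]\Big)\cdot\Big(\partial^k\prod_{j\in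 J}D_{(\mathcal I,m_j)}\prod_{l\in L}D_{(\Xi,l)}\Big)F_a$$ when the root of $\tau$ has decorations $\mathfrak n=k$, $\mathfrak o=a$ and carries the noise edges $\Xi_l$ ($l\in L$) and the kernel branches $\mathcal I_{m_j}[\tau_j]$ ($j\in J$); extend linearly. For $g\in G_-^{\rm ex}$ let $\mathbf F^g=\{F^g_a\}$ with $F_a^g=\Upsilon^{\mathbf F}[M_g^*\mathbf 1^a]$. The orbit $F^{G_-^{\rm ex}}$ of a non-linearity $F$ is $\{\mathbf F^g: g\in G_-^{\rm ex}\}$ where $\mathbf F$ is the family with $F_0=F$ and $F_a=0$ for $a\neq0$. **Proposition.** Suppose that the non-linearity $F$ obeys $R$ and let $\mathbf F=\{F_a\}\in F^{G_-^{\rm ex}}$. Then: 1. for every $a\in\mathbb R$ and every finite multiset $O$ of edge types with $O\notin\tilde R(a)$, one has $\big(\prod_{o\in O}D_o\big)F_a=0$; 2. $\Upsilon^{\mathbf F}[\tau]=0$ for every $\tau\in\mathfrak T^{\rm ex}\setminus\mathfrak T^{\rm ex}_\circ$. -/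

import Mathlib

open scoped TensorProduct ContDiff

noncomputable section

namespace RegTrees

/-! ### Edge types, degrees, rules -/

/-- The two types of edges: `noise` stands for `Ξ` and `kernel` for `𝓘`. -/
inductive EdgeKind : Type
  | noise : EdgeKind
  | kernel : EdgeKind

/-- Edge types: pairs of a type and a multi-index in `ℕ^d`. -/
abbrev EdgeType (d : ℕ) : Type := EdgeKind × (Fin d → ℕ)

/-- A scaling in `[1,∞)^d` with degrees of the two types, `|Ξ| < 0 < |𝓘|`. -/
structure DegreeMap (d : ℕ) where
  scale : Fin d → ℝ
  one_le_scale : ∀ i, 1 ≤ scale i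
  deg : EdgeKind → ℝ
  noise_neg : deg EdgeKind.noise < 0
  kernel_pos : 0 < deg EdgeKind.kernel

namespace DegreeMap

variable {d : ℕ}

/-- `|k| = ∑ i, k i * s i`. -/
def polyDeg (δ : DegreeMap d) (k : Fin d → ℕ) : ℝ := ∑ i, (k i : ℝ) * δ.scale i

/-- `|𝔱_k| = |𝔱| - |k|`. -/
def edgeDeg (δ : DegreeMap d) (o : EdgeType d) : ℝ := δ.deg o.1 - δ.polyDeg o.2

end DegreeMap

/-- A rule (a set of multisets of edge types) is normal if it is closed under sub-multisets. -/
def IsNormal {d : ℕ} (R : Set (Multiset (EdgeType d))) : Prop :=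
  ∀ A B : Multiset (EdgeType d), A ≤ B → B ∈ R → A ∈ R

/-- Subcriticality; the number `c` is a lower bound for `reg N`, `N ∈ R`, so that the last two
clauses say `reg 𝓘 < |𝓘| + inf_{N ∈ R} reg N` (with infimum `+∞` for the empty rule). -/
def IsSubcritical {d : ℕ} (δ : DegreeMap d) (R : Set (Multiset (EdgeType d))) : Prop :=
  ∃ reg : EdgeKind → ℝ, reg EdgeKind.noise < δ.deg EdgeKind.noise ∧
    ∃ c : ℝ, (∀ N ∈ R, c ≤ (N.map fun o => reg o.1 - δ.polyDeg o.2).sum) ∧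
      reg EdgeKind.kernel < δ.deg EdgeKind.kernel + c

/-! ### Decorated rooted trees -/

/-- A finite rooted tree with decorations. Edges are oriented away from the root and are identified
with their upper end: the node `v ≠ root` stands for the edge `(parent v, v)`. The value of `edge`
at the root carries no meaning. `poly` is the polynomial decoration and `ext` the extended one. -/
structure DecTree (d : ℕ) : Type 1 where
  Node : Type
  fintypeNode : Fintype Node
  root : Node
  parent : Node → Node
  parent_root : parent root = root
  reaches_root : ∀ v, ∃ k : ℕ, parent^[k] v = root
  poly : Node → Fin d → ℕ
  ext : Node → ℝ
  edge : Node → EdgeType d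
  noise_leaf : ∀ v, v ≠ root → (edge v).1 = EdgeKind.noise →
    (∀ w, w ≠ root → parent w ≠ v) ∧ poly v = 0 ∧ ext v = 0

namespace DecTree

variable {d : ℕ}

instance (τ : DecTree d) : Fintype τ.Node := τ.fintypeNode

instance (τ : DecTree d) : DecidableEq τ.Node := Classical.decEq _

/-- Isomorphism of decorated rooted trees. -/
def Iso (τ σ : DecTree d) : Prop :=
  ∃ φ : τ.Node ≃ σ.Node, φ τ.root = σ.root ∧ (∀ v, φ (τ.parent v) = σ.parent (φ v)) ∧
    (∀ v, σ.poly (φ v) = τ.poly v) ∧ (∀ v, σ.ext (φ v) = τ.ext v) ∧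
    ∀ v, v ≠ τ.root → σ.edge (φ v) = τ.edge v

theorem Iso.refl (τ : DecTree d) : Iso τ τ :=
  ⟨Equiv.refl _, rfl, fun _ => rfl, fun _ => rfl, fun _ => rfl, fun _ _ => rfl⟩

theorem Iso.symm {τ σ : DecTree d} : Iso τ σ → Iso σ τ := by
  rintro ⟨φ, h1, h2, h3, h4, h5⟩
  refine ⟨φ.symm, by simp [← h1], fun v => ?_, fun v => ?_, fun v => ?_, fun v hv => ?_⟩
  · apply φ.injective
    simp [h2]
  · simpa using (h3 (φ.symm v)).symm
  · simpa using (h4 (φ.symm v)).symm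
  · have hv' : φ.symm v ≠ τ.root := by
      intro h
      apply hv
      rw [← h1, ← h]
      simp
    simpa using (h5 _ hv').symm

theorem Iso.trans {τ σ ρ : DecTree d} : Iso τ σ → Iso σ ρ → Iso τ ρ := by
  rintro ⟨φ, h1, h2, h3, h4, h5⟩ ⟨ψ, k1, k2, k3, k4, k5⟩
  refine ⟨φ.trans ψ, by simp [h1, k1], fun v => by simp [h2, k2], fun v => by simp [h3, k3],
    fun v => by simp [h4, k4], fun v hv => ?_⟩
  have hv' : φ v ≠ σ.root := by
    intro h
    exact hv (φ.injective (h.trans h1.symm))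
  simp [h5 v hv, k5 _ hv']

instance isoSetoid (d : ℕ) : Setoid (DecTree d) where
  r := Iso
  iseqv := ⟨Iso.refl, Iso.symm, Iso.trans⟩

end DecTree

/-- The set `𝔗^ex` of combinatorial trees: decorated trees up to isomorphism. -/
def TreeClass (d : ℕ) : Type 1 := Quotient (DecTree.isoSetoid d)

namespace DecTree

variable {d : ℕ}

/-- The isomorphism class of a tree. -/
def toClass (τ : DecTree d) : TreeClass d := Quotient.mk _ τ

/-- The upper ends of the edges leaving `x`. -/
def children (τ : DecTree d) (x : τ.Node) : Finset τ.Node :=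
  Finset.univ.filter fun v => v ≠ τ.root ∧ τ.parent v = x

/-- The multiset `𝓝(x)` of the types of the edges leaving `x`. -/
def outEdges (τ : DecTree d) (x : τ.Node) : Multiset (EdgeType d) :=
  (τ.children x).val.map τ.edge

/-- Noise nodes are the upper ends of noise edges. -/
def IsNoiseNode (τ : DecTree d) (x : τ.Node) : Prop :=
  x ≠ τ.root ∧ (τ.edge x).1 = EdgeKind.noise

/-- The degree `|τ|_𝔰`, which ignores the extended decoration. -/
def degree (δ : DegreeMap d) (τ : DecTree d) : ℝ :=
  ∑ v, δ.polyDeg (τ.poly v) + ∑ v ∈ Finset.univ.filter (fun v => v ≠ τ.root), δ.edgeDeg (τ.edge v)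

/-- The tree belongs to `𝔗` (no extended decoration) and strongly conforms to the rule `R`. -/
def Conforms (R : Set (Multiset (EdgeType d))) (τ : DecTree d) : Prop :=
  (∀ x, τ.ext x = 0) ∧ ∀ x, τ.outEdges x ∈ R

/-- `τ = 𝟏^p Ξ_l` or `τ = 𝟏^p 𝓘_m[σ]`. -/
def IsPlanted (τ : DecTree d) : Prop :=
  τ.poly τ.root = 0 ∧ (τ.children τ.root).card = 1

/-- The tree `𝟏^a` with one node, with extended decoration `a`. -/
def unit (d : ℕ) (a : ℝ) : DecTree d where
  Node := Unit
  fintypeNode := inferInstance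
  root := ()
  parent := id
  parent_root := rfl
  reaches_root := fun _ => ⟨0, rfl⟩
  poly := fun _ => 0
  ext := fun _ => a
  edge := fun _ => (EdgeKind.kernel, 0)
  noise_leaf := fun _ hv => absurd rfl hv

theorem iterate_root (τ : DecTree d) (k : ℕ) : τ.parent^[k] τ.root = τ.root :=
  Function.iterate_fixed τ.parent_root k

open Classical in
/-- The part of the tree above the node `y`, with root `y`. -/
def subtree (τ : DecTree d) (y : τ.Node) : DecTree d where
  Node := {v : τ.Node // ∃ k : ℕ, τ.parent^[k] v = y}
  fintypeNode := inferInstance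
  root := ⟨y, 0, rfl⟩
  parent := fun v => if h : v.1 = y then v else ⟨τ.parent v.1, by
    obtain ⟨v, k, hk⟩ := v
    cases k with
    | zero => exact absurd hk h
    | succ k => exact ⟨k, by simpa using hk⟩⟩
  parent_root := by simp
  reaches_root := by
    rintro ⟨v, k, hk⟩
    induction k generalizing v with
    | zero => exact ⟨0, Subtype.ext hk⟩
    | succ k ih =>
      by_cases h : v = y
      · exact ⟨0, Subtype.ext h⟩
      · obtain ⟨j, hj⟩ := ih (τ.parent v) (by simpa using hk)
        refine ⟨j + 1, ?_⟩
        rw [Function.iterate_succ_apply]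
        simpa [h] using hj
  poly := fun v => τ.poly v.1
  ext := fun v => τ.ext v.1
  edge := fun v => τ.edge v.1
  noise_leaf := by
    have key : ∀ v : {v : τ.Node // ∃ k : ℕ, τ.parent^[k] v = y}, v.1 ≠ y → v.1 ≠ τ.root := by
      rintro ⟨v, k, hk⟩ h h'
      apply h
      have h'' : v = τ.root := h'
      have h3 : τ.parent^[k] v = v := by rw [h'', τ.iterate_root]
      exact h3.symm.trans hk
    intro v hv hn
    have hv' : v.1 ≠ y := fun h => hv (Subtype.ext h)
    obtain ⟨h1, h2, h3⟩ := τ.noise_leaf v.1 (key v hv') hn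
    refine ⟨fun w hw => ?_, h2, h3⟩
    have hw' : w.1 ≠ y := fun h => hw (Subtype.ext h)
    intro h
    rw [dif_neg hw'] at h
    exact h1 w.1 (key w hw') (congrArg Subtype.val h)

open Classical in
/-- The branches leaving `x`: the types of the edges together with the trees on which they end. -/
def branches (τ : DecTree d) (x : τ.Node) : Multiset (EdgeType d × TreeClass d) :=
  (τ.children x).val.map fun y => (τ.edge y, (τ.subtree y).toClass)

open Classical in
/-- The factorial `τ!`. The recursion
`τ! = k! ∏ α_i! ∏ (τ_j!)^{β_j} β_j!`, where `α_i`, `β_j` are the multiplicities of the distinct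
branches at the root, is written out as a product over all nodes. -/
def treeFactorial (τ : DecTree d) : ℕ :=
  ∏ x, (∏ i, (τ.poly x i).factorial) *
    ∏ b ∈ (τ.branches x).toFinset, ((τ.branches x).count b).factorial

end DecTree

/-! ### Extraction and contraction of subforests -/

/-- A subgraph `A` of the tree (node set `nodes`, edge set `edges`, with edges represented by their
upper ends), with a polynomial decoration `nA ≤ 𝔫` on its nodes and a decoration `eA` of its
boundary, that is, of the edges that leave a node of `A` but do not belong to `A`. Both are
extended by zero. -/
structure Extraction {d : ℕ} (τ : DecTree d) where
  nodes : Finset τ.Node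
  edges : Finset τ.Node
  edges_ne_root : ∀ v ∈ edges, v ≠ τ.root
  edges_upper : ∀ v ∈ edges, v ∈ nodes
  edges_lower : ∀ v ∈ edges, τ.parent v ∈ nodes
  nA : τ.Node → Fin d → ℕ
  nA_le : ∀ v, nA v ≤ τ.poly v
  nA_support : ∀ v, v ∉ nodes → nA v = 0
  eA : τ.Node → Fin d → ℕ
  eA_support : ∀ v, ¬ (v ≠ τ.root ∧ v ∉ edges ∧ τ.parent v ∈ nodes) → eA v = 0

namespace Extraction

variable {d : ℕ} {τ : DecTree d}

theorem root_not_mem (P : Extraction τ) : τ.root ∉ P.edges :=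
  fun h => P.edges_ne_root _ h rfl

theorem exists_top (P : Extraction τ) (v : τ.Node) : ∃ k : ℕ, τ.parent^[k] v ∉ P.edges := by
  obtain ⟨k, hk⟩ := τ.reaches_root v
  exact ⟨k, hk ▸ P.root_not_mem⟩

/-- The lowest node of the connected component of `v` in the graph formed by all nodes of the tree
and the edges of `A`. Contracted components are represented by their lowest node. -/
def top (P : Extraction τ) (v : τ.Node) : τ.Node :=
  τ.parent^[Nat.find (P.exists_top v)] v

theorem top_not_mem (P : Extraction τ) (v : τ.Node) : P.top v ∉ P.edges :=
  Nat.find_spec (P.exists_top v)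

theorem top_of_not_mem (P : Extraction τ) {v : τ.Node} (h : v ∉ P.edges) : P.top v = v := by
  have : Nat.find (P.exists_top v) = 0 := by
    rw [Nat.find_eq_zero]
    exact h
  simp [top, this]

theorem top_of_mem (P : Extraction τ) {v : τ.Node} (h : v ∈ P.edges) :
    P.top v = P.top (τ.parent v) := by
  have h0 : ¬ (τ.parent^[0] v ∉ P.edges) := by simpa using h
  have h1 : ∃ k : ℕ, τ.parent^[k + 1] v ∉ P.edges := by
    obtain ⟨k, hk⟩ := P.exists_top (τ.parent v)
    exact ⟨k, by simpa using hk⟩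
  have : Nat.find (P.exists_top v) = Nat.find (P.exists_top (τ.parent v)) + 1 := by
    rw [Nat.find_comp_succ (P.exists_top v) h1 h0]
    congr 1
  rw [top, this, Function.iterate_succ_apply]
  rfl

theorem top_noise (P : Extraction τ) {v u : τ.Node} (hv : ∀ w, w ≠ τ.root → τ.parent w ≠ v)
    (h : P.top u = v) : u = v := by
  obtain ⟨k, hk⟩ : ∃ k : ℕ, τ.parent^[k] u = v := ⟨_, h⟩
  clear h
  induction k generalizing u with
  | zero => exact hk
  | succ k ih =>
    have h' := ih (u := τ.parent u) (by simpa using hk)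
    by_cases hu : u = τ.root
    · rw [← h', hu, τ.parent_root]
    · exact absurd h' (hv u hu)

/-- The sum `π e_A` of the boundary decorations over the edges leaving a node. -/
def piE (P : Extraction τ) (x : τ.Node) : Fin d → ℕ := ∑ v ∈ τ.children x, P.eA v

theorem piE_noise (P : Extraction τ) {v : τ.Node} (hv : ∀ w, w ≠ τ.root → τ.parent w ≠ v) :
    P.piE v = 0 := by
  unfold piE
  apply Finset.sum_eq_zero
  intro w hw
  simp only [DecTree.children, Finset.mem_filter, Finset.mem_univ, true_and] at hw
  exact absurd hw.2 (hv w hw.1)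

/-- The component of `A` with lowest node `w`, decorated by `𝔫_A + π 𝔢_A`, `𝔬` and `𝔢`. -/
def component (P : Extraction τ) (w : τ.Node) (hw : w ∉ P.edges) : DecTree d where
  Node := {v : τ.Node // P.top v = w}
  fintypeNode := inferInstance
  root := ⟨w, P.top_of_not_mem hw⟩
  parent := fun v => if h : v.1 ∈ P.edges then
    ⟨τ.parent v.1, by rw [← P.top_of_mem h]; exact v.2⟩ else v
  parent_root := by simp [hw]
  reaches_root := by
    rintro ⟨v, hv⟩
    obtain ⟨k, hk⟩ : ∃ k : ℕ, τ.parent^[k] v = w := ⟨_, hv⟩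
    induction k generalizing v with
    | zero => exact ⟨0, Subtype.ext hk⟩
    | succ k ih =>
      by_cases h : v ∈ P.edges
      · obtain ⟨j, hj⟩ := ih (τ.parent v) (by rw [← P.top_of_mem h]; exact hv) (by simpa using hk)
        refine ⟨j + 1, ?_⟩
        rw [Function.iterate_succ_apply]
        simpa [h] using hj
      · exact ⟨0, Subtype.ext ((P.top_of_not_mem h).symm.trans hv)⟩
  poly := fun v => P.nA v.1 + P.piE v.1
  ext := fun v => τ.ext v.1
  edge := fun v => τ.edge v.1
  noise_leaf := by
    have key : ∀ v : {v : τ.Node // P.top v = w}, v.1 ≠ w → v.1 ∈ P.edges := by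
      rintro ⟨v, hv⟩ h
      by_contra h'
      exact h ((P.top_of_not_mem h').symm.trans hv)
    intro v hv hn
    have hv' : v.1 ≠ w := fun h => hv (Subtype.ext h)
    obtain ⟨h1, h2, h3⟩ := τ.noise_leaf v.1 (P.edges_ne_root _ (key v hv')) hn
    refine ⟨fun u hu => ?_, ?_, h3⟩
    · have hu' : u.1 ≠ w := fun h => hu (Subtype.ext h)
      intro h
      rw [dif_pos (key u hu')] at h
      exact h1 u.1 (P.edges_ne_root _ (key u hu')) (congrArg Subtype.val h)
    · have h4 : P.nA v.1 = 0 := by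
        have := P.nA_le v.1
        rw [h2] at this
        exact le_antisymm this (fun _ => Nat.zero_le _)
      rw [h4, P.piE_noise h1, add_zero]

/-- The extracted forest: the multiset of the connected components of `A`. -/
def forest (P : Extraction τ) : Multiset (TreeClass d) :=
  (Finset.univ : Finset {w : τ.Node // w ∈ P.nodes ∧ w ∉ P.edges}).val.map
    fun w => (P.component w.1 w.2.2).toClass

/-- The contracted tree: the components of `A` become nodes, `𝔫 - 𝔫_A` is summed over components,
`𝔢_A` is added to the decorations of the remaining edges, and the extended decoration collects
`𝔬`, the degrees of the contracted edges and `|𝔫_A + π 𝔢_A|`. -/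
def contract (δ : DegreeMap d) (P : Extraction τ) : DecTree d where
  Node := {v : τ.Node // v ∉ P.edges}
  fintypeNode := inferInstance
  root := ⟨τ.root, P.root_not_mem⟩
  parent := fun v => ⟨P.top (τ.parent v.1), P.top_not_mem _⟩
  parent_root := by
    apply Subtype.ext
    simp only [τ.parent_root]
    exact P.top_of_not_mem P.root_not_mem
  reaches_root := by
    rintro ⟨v, hv⟩
    obtain ⟨n, hn⟩ := τ.reaches_root v
    induction n using Nat.strong_induction_on generalizing v with
    | _ n ih =>
      cases n with
      | zero => exact ⟨0, Subtype.ext hn⟩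
      | succ n =>
        have hn' : τ.parent^[n] (τ.parent v) = τ.root := by simpa using hn
        have hlt : n - Nat.find (P.exists_top (τ.parent v)) < n + 1 := by omega
        obtain ⟨j, hj⟩ := ih _ hlt (P.top (τ.parent v)) (P.top_not_mem _) (by
          rw [top, ← Function.iterate_add_apply]
          obtain ⟨m, hm⟩ : ∃ m, n - Nat.find (P.exists_top (τ.parent v)) +
              Nat.find (P.exists_top (τ.parent v)) = m + n :=
            ⟨n - Nat.find (P.exists_top (τ.parent v)) +
              Nat.find (P.exists_top (τ.parent v)) - n, by omega⟩
          rw [hm, Function.iterate_add_apply, hn', τ.iterate_root])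
        exact ⟨j + 1, by rw [Function.iterate_succ_apply]; exact hj⟩
  poly := fun w => ∑ v ∈ Finset.univ.filter (fun v => P.top v = w.1), (τ.poly v - P.nA v)
  ext := fun w =>
    ∑ v ∈ Finset.univ.filter (fun v => P.top v = w.1), (τ.ext v + δ.polyDeg (P.nA v + P.piE v)) +
      ∑ v ∈ P.edges.filter (fun v => P.top v = w.1), δ.edgeDeg (τ.edge v)
  edge := fun v => ((τ.edge v.1).1, (τ.edge v.1).2 + P.eA v.1)
  noise_leaf := by
    intro v hv hn
    have hv' : v.1 ≠ τ.root := fun h => hv (Subtype.ext h)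
    obtain ⟨h1, h2, h3⟩ := τ.noise_leaf v.1 hv' hn
    have h4 : P.nA v.1 = 0 := by
      have := P.nA_le v.1
      rw [h2] at this
      exact le_antisymm this (fun _ => Nat.zero_le _)
    refine ⟨fun w hw h => ?_, ?_, ?_⟩
    · exact h1 w.1 (fun h => hw (Subtype.ext h)) (P.top_noise h1 (congrArg Subtype.val h))
    · apply Finset.sum_eq_zero
      intro u hu
      have hu' := P.top_noise h1 (Finset.mem_filter.mp hu).2
      rw [hu', h2, h4]
      rfl
    · have e1 : ∑ u ∈ Finset.univ.filter (fun u => P.top u = v.1),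
          (τ.ext u + δ.polyDeg (P.nA u + P.piE u)) = 0 := by
        apply Finset.sum_eq_zero
        intro u hu
        have hu' := P.top_noise h1 (Finset.mem_filter.mp hu).2
        rw [hu', h3, h4, P.piE_noise h1]
        simp [DegreeMap.polyDeg]
      have e2 : ∑ u ∈ P.edges.filter (fun u => P.top u = v.1), δ.edgeDeg (τ.edge u) = 0 := by
        apply Finset.sum_eq_zero
        intro u hu
        have hu' := P.top_noise h1 (Finset.mem_filter.mp hu).2
        exact absurd (hu' ▸ (Finset.mem_filter.mp hu).1) v.2
      rw [e1, e2, add_zero]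

/-- The combinatorial coefficient `binom(𝔫, 𝔫_A) / 𝔢_A!`. -/
def coeff (P : Extraction τ) : ℝ :=
  (∏ v, ∏ i, ((τ.poly v i).choose (P.nA v i) : ℝ)) / ∏ v, ∏ i, ((P.eA v i).factorial : ℝ)

end Extraction

/-! ### Conforming trees, negative trees, and the group of negative characters -/

section Renormalisation

variable {d : ℕ} (δ : DegreeMap d) (R : Set (Multiset (EdgeType d)))

/-- `𝔗_-`: conforming trees without extended decoration, of negative degree, without polynomial
decoration at the root, and not planted. -/
def negTrees : Set (TreeClass d) :=
  {c | ∃ τ : DecTree d, τ.toClass = c ∧ τ.Conforms R ∧ τ.degree δ < 0 ∧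
    τ.poly τ.root = 0 ∧ ¬ τ.IsPlanted}

/-- `𝔗_∘^ex`: the trees obtained from conforming trees by extracting forests of negative trees. -/
def extTrees : Set (TreeClass d) :=
  {c | ∃ (τ : DecTree d) (P : Extraction τ), τ.Conforms R ∧ (∀ t ∈ P.forest, t ∈ negTrees δ R) ∧
    (P.contract δ).toClass = c}

/-- `R̃(a)`: the edge types leaving the root of a tree of `𝔗_∘^ex` with extended decoration `a` at
the root. -/
def extRule (a : ℝ) : Set (Multiset (EdgeType d)) :=
  {N | ∃ τ : DecTree d, τ.toClass ∈ extTrees δ R ∧ τ.ext τ.root = a ∧ τ.outEdges τ.root = N}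

/-- `𝔗_-^ex`. -/
def negExtTrees : Set (TreeClass d) :=
  {c | ∃ τ : DecTree d, τ.toClass = c ∧ c ∈ extTrees δ R ∧ τ.degree δ < 0 ∧
    τ.poly τ.root = 0 ∧ ¬ τ.IsPlanted}

/-- `𝔉_-^ex`: forests of trees of `𝔗_-^ex`, with the forest product written additively. -/
def negForests : AddSubmonoid (Multiset (TreeClass d)) where
  carrier := {f | ∀ t ∈ f, t ∈ negExtTrees δ R}
  zero_mem' := by simp
  add_mem' := by
    intro f g hf hg t ht
    rcases Multiset.mem_add.mp ht with h | h
    · exact hf t h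
    · exact hg t h

/-- The algebra `𝓕_-^ex` spanned by `𝔉_-^ex`. -/
abbrev NegAlgebra : Type 1 := AddMonoidAlgebra ℝ (negForests δ R)

/-- The group `G_-^ex` of characters of `𝓕_-^ex`. -/
abbrev NegChar : Type 1 := NegAlgebra δ R →ₐ[ℝ] ℝ

open Classical in
/-- The projection `π_-^ex` of forests to `𝓕_-^ex`. -/
def projNeg (f : Multiset (TreeClass d)) : NegAlgebra δ R :=
  if h : f ∈ negForests δ R then AddMonoidAlgebra.single ⟨f, h⟩ 1 else 0

/-- The space `𝓥^ex` spanned by `𝔗^ex`. -/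
abbrev TreeSpace (d : ℕ) : Type 1 := TreeClass d →₀ ℝ

/-- `Δ^-_ex τ` for a tree `τ`. Only finitely many terms of the sum are non-zero. -/
def coactTree (τ : DecTree d) : NegAlgebra δ R ⊗[ℝ] TreeSpace d :=
  ∑ᶠ P : Extraction τ,
    P.coeff • (projNeg δ R P.forest ⊗ₜ[ℝ] Finsupp.single (P.contract δ).toClass (1 : ℝ))

/-- The linear map `Δ^-_ex`, computed on any representatives of isomorphism classes. -/
def coaction : TreeSpace d →ₗ[ℝ] NegAlgebra δ R ⊗[ℝ] TreeSpace d :=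
  Finsupp.linearCombination ℝ fun c : TreeClass d => coactTree δ R (Quotient.out c)

variable {δ R}

/-- `M_g = (g ⊗ id) Δ^-_ex`. -/
def renorm (g : NegChar δ R) : TreeSpace d →ₗ[ℝ] TreeSpace d :=
  (TensorProduct.lid ℝ (TreeSpace d)).toLinearMap ∘ₗ
    LinearMap.rTensor (TreeSpace d) g.toLinearMap ∘ₗ coaction δ R

/-- The factorial of an isomorphism class. -/
def classFactorial (c : TreeClass d) : ℝ := ((Quotient.out c : DecTree d).treeFactorial : ℝ)

/-- The inner product on `𝓥^ex` for which trees are orthogonal with `⟨τ, τ⟩ = τ!`. -/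
def treeInner (u v : TreeSpace d) : ℝ := u.sum fun c x => x * v c * classFactorial c

open Classical in
/-- The adjoint `M_g^* σ = ∑_{τ ∈ 𝔗_∘^ex} (⟨σ, M_g τ⟩ / τ!) τ`, as the function that assigns to a
tree its coefficient. -/
def renormAdj (g : NegChar δ R) (u : TreeSpace d) : TreeClass d → ℝ := fun c =>
  if c ∈ extTrees δ R then treeInner u (renorm g (Finsupp.single c 1)) / classFactorial c else 0

end Renormalisation

/-! ### Non-linearities and the coherence map -/

section Nonlinearities

variable {d : ℕ}

/-- Functions on `ℝ^𝓔`. -/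
abbrev JetFun (d : ℕ) : Type := (EdgeType d → ℝ) → ℝ

/-- A non-linearity: a smooth function of finitely many components. -/
def IsNonlinearity (F : JetFun d) : Prop :=
  ∃ (s : Finset (EdgeType d)) (f : (s → ℝ) → ℝ), ContDiff ℝ ∞ f ∧
    ∀ y : EdgeType d → ℝ, F y = f fun o => y o

open Classical in
/-- The partial derivative `D_o`. -/
def pderiv (o : EdgeType d) (F : JetFun d) : JetFun d := fun y =>
  deriv (fun t : ℝ => F (Function.update y o t)) (y o)

/-- `D_{o_1} ⋯ D_{o_n} F` for the list `[o_1, …, o_n]`. -/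
def pderivs (l : List (EdgeType d)) (F : JetFun d) : JetFun d := l.foldr pderiv F

/-- `F` obeys the rule `R`. -/
def Obeys (F : JetFun d) (R : Set (Multiset (EdgeType d))) : Prop :=
  ∀ l : List (EdgeType d), (l : Multiset (EdgeType d)) ∉ R → pderivs l F = 0

/-- `∂^i F = ∑_p Y_{(𝓘, p + e_i)} D_{(𝓘, p)} F`, a finite sum when `F` is a non-linearity. -/
def shiftDeriv (i : Fin d) (F : JetFun d) : JetFun d := fun y =>
  ∑ᶠ p : Fin d → ℕ, y (EdgeKind.kernel, p + Pi.single i 1) * pderiv (EdgeKind.kernel, p) F y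

/-- `∂^k`, the composition of the commuting operators `∂^i`, each applied `k i` times. -/
def shiftDerivs (k : Fin d → ℕ) (F : JetFun d) : JetFun d :=
  (List.finRange d).foldr (fun i G => (shiftDeriv i)^[k i] G) F

open Classical in
/-- The coherence map `Υ` of the family `FF` on a tree. The recursion
`Υ[τ] = (∏_j Υ[τ_j]) · (∂^k ∏_j D_{(𝓘, m_j)} ∏_l D_{(Ξ, l)}) F_a` is written out as a product over
all nodes that are not noise nodes. Derivatives commute, so their order does not matter. -/
def upsilon (FF : ℝ → JetFun d) (τ : DecTree d) : JetFun d :=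
  ∏ x ∈ Finset.univ.filter (fun x => ¬ τ.IsNoiseNode x),
    shiftDerivs (τ.poly x) (pderivs (τ.outEdges x).toList (FF (τ.ext x)))

/-- The linear extension of `Υ` to combinations of trees, given by their coefficients. -/
def upsilonLin (FF : ℝ → JetFun d) (u : TreeClass d → ℝ) : JetFun d :=
  ∑ᶠ c : TreeClass d, u c • upsilon FF (Quotient.out c : DecTree d)

/-- The reduced extended non-linearity given by `F`. Families of non-linearities indexed by `a ≤ 0`
are extended by zero to all real `a`. -/
def reduced (F : JetFun d) : ℝ → JetFun d := Pi.single 0 F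

variable {δ : DegreeMap d} {R : Set (Multiset (EdgeType d))}

/-- The action of `G_-^ex` on extended non-linearities, `F^g_a = Υ[M_g^* 𝟏^a]`. -/
def act (FF : ℝ → JetFun d) (g : NegChar δ R) : ℝ → JetFun d := fun a =>
  upsilonLin FF (renormAdj g (Finsupp.single (DecTree.unit d a).toClass 1))

variable (δ R)

/-- The orbit of a non-linearity under `G_-^ex`. -/
def orbit (F : JetFun d) : Set (ℝ → JetFun d) :=
  Set.range fun g : NegChar δ R => act (reduced F) g

end Nonlinearities

end RegTrees

end

noncomputable section

namespace RegTrees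

variable {d : ℕ}

/-! ### The algebra of non-linearities and its derivations -/

/-! Both claims follow from one local statement: if `∂^k D_O F_a` does not vanish, then a node with
polynomial decoration `k`, outgoing edges `O` and extended decoration `a` can be produced by
contracting a piece `σ` of a conforming tree. This is the predicate `Admissible`, and the statement
is `admissible_of_ne_zero`.

Why it holds: `F_a` is a combination of functions `Υ[σ]` over trees `σ` for which `𝟏^a` occurs in
`M_g σ`. Contracting part of `σ` then leaves a single node, so `σ` is either one node or extracted
as a whole, with degree `a` (`Extraction.of_contract_iso_unit`). Since the initial family lives at
index `0`, only `σ` without extended decoration matters. Now `Υ[σ]` is a product over the nodes of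
`σ`, and the Leibniz rule distributes the derivatives over these nodes. A derivative `D_o` meeting
the operators `∂^i` at a node either commutes with `∂^i` or absorbs it, `D_{(𝓘, q + e_i)} ∂^i = ∂^i
D_{(𝓘, q + e_i)} + D_{(𝓘, q)}`. Hence each edge of `O` is attached to a node of `σ` with its type
lowered at the expense of the polynomial decoration there, while `∂^k` adds the decoration `k` to
the nodes. This is what an extraction undoes: the lowerings are `𝔢_A`, and what is left of the
decoration of `σ` is `𝔫_A`. As `F` obeys the rule, a non-zero term forces every node of `σ` with its
attached edges to conform (`exists_isSpread`).

Conversely, if all non-noise nodes of a tree are admissible, gluing the pieces into the nodes yields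
a conforming tree that contracts to the given one (`Gluing.toClass_mem_extTrees`). The second claim
follows since `Υ[τ]` is a product over nodes, and the first by applying this to a corolla. -/

theorem pderiv_apply [DecidableEq (EdgeType d)] (o : EdgeType d) (F : JetFun d)
    (y : EdgeType d → ℝ) :
    pderiv o F y = deriv (fun t : ℝ => F (Function.update y o t)) (y o) := by
  unfold pderiv
  congr!

/-! ### Smooth functions of finitely many coordinates -/

namespace IsNonlinearity

variable {F G : JetFun d}

/-- Lets two non-linearities, or a non-linearity and a direction of differentiation, share one
finite set of variables. -/
theorem exists_of_subset {s s' : Finset (EdgeType d)} (h : s ⊆ s') {f : (s → ℝ) → ℝ}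
    (hf : ContDiff ℝ ∞ f) (hF : ∀ y : EdgeType d → ℝ, F y = f fun o => y o) :
    ∃ f' : (s' → ℝ) → ℝ, ContDiff ℝ ∞ f' ∧ ∀ y : EdgeType d → ℝ, F y = f' fun o => y o :=
  ⟨fun z => f fun o => z ⟨o.1, h o.2⟩,
    hf.comp (contDiff_pi.mpr fun o => contDiff_apply ℝ ℝ (⟨o.1, h o.2⟩ : s')), fun y => hF y⟩

theorem const (c : ℝ) : IsNonlinearity (d := d) fun _ => c :=
  ⟨∅, fun _ => c, contDiff_const, fun _ => rfl⟩

theorem coord (o : EdgeType d) : IsNonlinearity fun y => y o :=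
  ⟨{o}, fun z => z ⟨o, by simp⟩, contDiff_apply ℝ ℝ _, fun _ => rfl⟩

theorem add (hF : IsNonlinearity F) (hG : IsNonlinearity G) : IsNonlinearity (F + G) := by
  classical
  obtain ⟨s, f, hf, hF⟩ := hF
  obtain ⟨t, g, hg, hG⟩ := hG
  obtain ⟨f', hf', hF'⟩ := exists_of_subset (Finset.subset_union_left (s₂ := t)) hf hF
  obtain ⟨g', hg', hG'⟩ := exists_of_subset (Finset.subset_union_right (s₁ := s)) hg hG
  exact ⟨s ∪ t, f' + g', hf'.add hg', fun y => by simp [hF', hG']⟩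

theorem mul (hF : IsNonlinearity F) (hG : IsNonlinearity G) : IsNonlinearity (F * G) := by
  classical
  obtain ⟨s, f, hf, hF⟩ := hF
  obtain ⟨t, g, hg, hG⟩ := hG
  obtain ⟨f', hf', hF'⟩ := exists_of_subset (Finset.subset_union_left (s₂ := t)) hf hF
  obtain ⟨g', hg', hG'⟩ := exists_of_subset (Finset.subset_union_right (s₁ := s)) hg hG
  exact ⟨s ∪ t, f' * g', hf'.mul hg', fun y => by simp [hF', hG']⟩

/-- Reduces `pderiv` to calculus on the finite-dimensional space `s → ℝ`, from which smoothness and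
the symmetry of second derivatives are inherited. -/
theorem pderiv_eq [DecidableEq (EdgeType d)] {s : Finset (EdgeType d)} {f : (s → ℝ) → ℝ}
    (hf : ContDiff ℝ ∞ f) (hF : ∀ y : EdgeType d → ℝ, F y = f fun o => y o)
    {o : EdgeType d} (ho : o ∈ s) (y : EdgeType d → ℝ) :
    (∀ t, DifferentiableAt ℝ (fun t : ℝ => F (Function.update y o t)) t) ∧
    pderiv o F y =
      fderiv ℝ f (fun o => y o) (Pi.single (⟨o, ho⟩ : s) (1 : ℝ)) := by
  have hupd : ∀ t : ℝ, (fun o' : s => Function.update y o t o'.1) =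
      Function.update (fun o' : s => y o') ⟨o, ho⟩ t := by
    intro t
    ext o'
    by_cases h : o' = ⟨o, ho⟩
    · subst h; simp
    · have h' : o'.1 ≠ o := fun e => h (Subtype.ext e)
      simp [h, h']
  have hd : ∀ t : ℝ, HasDerivAt
      (fun t : ℝ => F (Function.update y o t))
      (fderiv ℝ f (Function.update (fun o' : s => y o') ⟨o, ho⟩ t)
        (Pi.single (⟨o, ho⟩ : s) (1 : ℝ))) t := by
    intro t
    simp only [hF, hupd]
    have h1 := hasDerivAt_update (𝕜 := ℝ) (fun o' : s => y o') ⟨o, ho⟩ t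
    have h2 := ((hf.differentiable (by simp)) (Function.update (fun o' : s => y o') ⟨o, ho⟩ t)
      ).hasFDerivAt
    exact h2.comp_hasDerivAt t h1
  refine ⟨fun t => (hd t).differentiableAt, ?_⟩
  have h := (hd (y o)).deriv
  have e : Function.update (fun o' : s => y o') ⟨o, ho⟩ (y o) =
      fun o' : s => y o' := Function.update_eq_self (⟨o, ho⟩ : s) (fun o' : s => y o')
  rw [e] at h
  rw [← h, pderiv_apply]

theorem differentiableAt_line [DecidableEq (EdgeType d)] (hF : IsNonlinearity F) (o : EdgeType d)
    (y : EdgeType d → ℝ) (t : ℝ) :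
    DifferentiableAt ℝ (fun t : ℝ => F (Function.update y o t)) t := by
  obtain ⟨s, f, hf, hF⟩ := hF
  obtain ⟨f', hf', hF'⟩ := exists_of_subset (Finset.subset_insert o s) hf hF
  exact (pderiv_eq hf' hF' (Finset.mem_insert_self o s) y).1 t

theorem pderiv_isNonlinearity (hF : IsNonlinearity F) (o : EdgeType d) :
    IsNonlinearity (pderiv o F) := by
  classical
  obtain ⟨s, f, hf, hF⟩ := hF
  obtain ⟨f', hf', hF'⟩ := exists_of_subset (Finset.subset_insert o s) hf hF
  exact ⟨_, _, (hf'.fderiv_right (by simp)).clm_apply contDiff_const,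
    fun y => (pderiv_eq hf' hF' (Finset.mem_insert_self o s) y).2⟩

theorem finite_pderiv_ne_zero (hF : IsNonlinearity F) : {o | pderiv o F ≠ 0}.Finite := by
  classical
  obtain ⟨s, f, hf, hF⟩ := hF
  refine s.finite_toSet.subset fun o ho => ?_
  by_contra h
  apply ho
  ext y
  have : (fun t : ℝ => F (Function.update y o t)) = fun _ => F y := by
    ext t
    rw [hF, hF]
    congr 1
    ext o'
    rw [Function.update_of_ne]
    rintro rfl
    exact h o'.2
  rw [pderiv_apply, this]
  simp

/-- Symmetry of the second Fréchet derivative, once both directions belong to the finite set of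
variables. -/
theorem pderiv_comm (hF : IsNonlinearity F) (o o' : EdgeType d) :
    pderiv o (pderiv o' F) = pderiv o' (pderiv o F) := by
  classical
  obtain ⟨s, f, hf, hF⟩ := hF
  obtain ⟨s', hss, ho, ho'⟩ : ∃ s' : Finset (EdgeType d), s ⊆ s' ∧ o ∈ s' ∧ o' ∈ s' :=
    ⟨insert o' (insert o s), (Finset.subset_insert _ _).trans (Finset.subset_insert _ _), by simp,
      by simp⟩
  obtain ⟨g, hg, hG⟩ := exists_of_subset hss hf hF
  have hs : ∀ v : s' → ℝ, ContDiff ℝ ∞ fun z => fderiv ℝ g z v := fun v =>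
    (hg.fderiv_right (m := ∞) (by simp)).clm_apply contDiff_const
  ext y
  rw [(pderiv_eq (hs _) (fun y => (pderiv_eq hg hG ho' y).2) ho y).2,
    (pderiv_eq (hs _) (fun y => (pderiv_eq hg hG ho y).2) ho' y).2]
  have hd : DifferentiableAt ℝ (fderiv ℝ g) fun o : s' => y o :=
    (hg.fderiv_right (m := ∞) (by simp)).differentiable (by simp) _
  have key : ∀ v w : s' → ℝ, fderiv ℝ (fun z => fderiv ℝ g z v) (fun o : s' => y o) w =
      fderiv ℝ (fderiv ℝ g) (fun o : s' => y o) w v := by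
    intro v w
    rw [fderiv_clm_apply hd (differentiableAt_const v)]
    simp
  rw [key, key]
  exact (hg.contDiffAt.isSymmSndFDerivAt (by
    rw [minSmoothness_of_isRCLikeNormedField]
    exact WithTop.coe_le_coe.mpr (le_top : (2 : ℕ∞) ≤ ⊤))) _ _

end IsNonlinearity

variable (d) in
/-- The algebra of non-linearities. -/
def nonlinearities : Subalgebra ℝ (JetFun d) where
  carrier := {F | IsNonlinearity F}
  mul_mem' := IsNonlinearity.mul
  add_mem' := IsNonlinearity.add
  algebraMap_mem' := fun c => IsNonlinearity.const c

/-- The partial derivative as a derivation of the algebra of non-linearities. -/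
def pderivation (o : EdgeType d) : Derivation ℝ (nonlinearities d) (nonlinearities d) :=
  Derivation.mk'
    { toFun := fun F => ⟨pderiv o F.1, F.2.pderiv_isNonlinearity o⟩
      map_add' := fun F G => by
        ext y
        classical
        change pderiv o (F.1 + G.1) y = pderiv o F.1 y + pderiv o G.1 y
        simp only [pderiv_apply]
        exact deriv_add (F.2.differentiableAt_line o y (y o)) (G.2.differentiableAt_line o y (y o))
      map_smul' := fun c F => by
        ext y
        classical
        change pderiv o (c • F.1) y = c * pderiv o F.1 y
        simp only [pderiv_apply]
        exact deriv_const_mul c (F.2.differentiableAt_line o y (y o)) }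
    fun F G => by
      ext y
      classical
      have h := deriv_mul (F.2.differentiableAt_line o y (y o))
        (G.2.differentiableAt_line o y (y o))
      simp only [Function.update_eq_self, ← pderiv_apply] at h
      change pderiv o (F.1 * G.1) y = F.1 y * pderiv o G.1 y + G.1 y * pderiv o F.1 y
      rw [pderiv_apply]
      refine h.trans ?_
      ring

@[simp]
theorem coe_pderivation (o : EdgeType d) (F : nonlinearities d) :
    (pderivation o F : JetFun d) = pderiv o F.1 := rfl

theorem pderivation_comm (o o' : EdgeType d) (F : nonlinearities d) :
    pderivation o (pderivation o' F) = pderivation o' (pderivation o F) :=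
  Subtype.ext (F.2.pderiv_comm o o')

theorem finite_pderivation_ne_zero (F : nonlinearities d) :
    {p : Fin d → ℕ | pderivation (EdgeKind.kernel, p) F ≠ 0}.Finite := by
  have h := F.2.finite_pderiv_ne_zero.preimage
    (f := fun p : Fin d → ℕ => (EdgeKind.kernel, p)) (fun a _ b _ h => (Prod.mk.inj h).2)
  exact h.subset fun p hp hp' => hp (Subtype.ext hp')

/-- The coordinate functions as non-linearities. -/
def coordinate (o : EdgeType d) : nonlinearities d := ⟨fun y => y o, IsNonlinearity.coord o⟩

theorem pderivation_coordinate_self (o : EdgeType d) : pderivation o (coordinate o) = 1 := by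
  classical
  ext y
  change pderiv o (fun y => y o) y = 1
  simp [pderiv_apply]

theorem pderivation_coordinate_of_ne {o o' : EdgeType d} (h : o' ≠ o) :
    pderivation o (coordinate o') = 0 := by
  classical
  ext y
  change pderiv o (fun y => y o') y = 0
  simp [pderiv_apply, h]

/-- The set `s` may be larger than necessary, so that the sums for `F`, `G`, `F + G` and `F * G` can
be compared over a common index set. -/
theorem shiftDeriv_eq_sum (i : Fin d) (F : nonlinearities d) (s : Finset (Fin d → ℕ))
    (hs : ∀ p, p ∉ s → pderivation (EdgeKind.kernel, p) F = 0) :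
    shiftDeriv i F.1 = ((∑ p ∈ s, coordinate (EdgeKind.kernel, p + Pi.single i 1) *
      pderivation (EdgeKind.kernel, p) F : nonlinearities d) : JetFun d) := by
  classical
  ext y
  rw [shiftDeriv, finsum_eq_sum_of_support_subset (s := s)]
  · simp [coordinate]
  · intro p hp
    by_contra h
    apply hp
    have := congrArg Subtype.val (hs p h)
    have h2 : pderiv (EdgeKind.kernel, p) F.1 = 0 := this
    simp [h2]

/-- The operator `∂^i` as a derivation of the algebra of non-linearities. -/
def shiftDerivation (i : Fin d) : Derivation ℝ (nonlinearities d) (nonlinearities d) :=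
  Derivation.mk'
    { toFun := fun F => ⟨shiftDeriv i F.1, by
        rw [shiftDeriv_eq_sum i F (finite_pderivation_ne_zero F).toFinset fun p hp => by
          simpa using hp]
        exact Subtype.property _⟩
      map_add' := fun F G => by
        classical
        apply Subtype.ext
        set s := (finite_pderivation_ne_zero F).toFinset ∪ (finite_pderivation_ne_zero G).toFinset
        have hF : ∀ p, p ∉ s → pderivation (EdgeKind.kernel, p) F = 0 := by
          intro p hp
          simp only [s, Finset.mem_union, Set.Finite.mem_toFinset, Set.mem_ofPred_eq,
            not_or, not_not] at hp
          exact hp.1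
        have hG : ∀ p, p ∉ s → pderivation (EdgeKind.kernel, p) G = 0 := by
          intro p hp
          simp only [s, Finset.mem_union, Set.Finite.mem_toFinset, Set.mem_ofPred_eq,
            not_or, not_not] at hp
          exact hp.2
        change shiftDeriv i (F + G : nonlinearities d).1 = shiftDeriv i F.1 + shiftDeriv i G.1
        rw [shiftDeriv_eq_sum i F s hF, shiftDeriv_eq_sum i G s hG,
          shiftDeriv_eq_sum i (F + G) s fun p hp => by simp [hF p hp, hG p hp],
          ← Subalgebra.coe_add, ← Finset.sum_add_distrib]
        simp only [map_add, mul_add]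
      map_smul' := fun c F => by
        apply Subtype.ext
        set s := (finite_pderivation_ne_zero F).toFinset
        have hF : ∀ p, p ∉ s → pderivation (EdgeKind.kernel, p) F = 0 := by
          intro p hp; simpa [s] using hp
        change shiftDeriv i (c • F : nonlinearities d).1 = c • shiftDeriv i F.1
        rw [shiftDeriv_eq_sum i F s hF, shiftDeriv_eq_sum i (c • F) s fun p hp => by simp [hF p hp],
          ← Subalgebra.coe_smul, Finset.smul_sum]
        simp only [Derivation.map_smul, mul_smul_comm] }
    fun F G => by
      classical
      apply Subtype.ext
      set s := (finite_pderivation_ne_zero F).toFinset ∪ (finite_pderivation_ne_zero G).toFinset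
      have hF : ∀ p, p ∉ s → pderivation (EdgeKind.kernel, p) F = 0 := by
        intro p hp
        simp only [s, Finset.mem_union, Set.Finite.mem_toFinset, Set.mem_ofPred_eq,
          not_or, not_not] at hp
        exact hp.1
      have hG : ∀ p, p ∉ s → pderivation (EdgeKind.kernel, p) G = 0 := by
        intro p hp
        simp only [s, Finset.mem_union, Set.Finite.mem_toFinset, Set.mem_ofPred_eq,
          not_or, not_not] at hp
        exact hp.2
      change shiftDeriv i (F * G : nonlinearities d).1 =
        F.1 * shiftDeriv i G.1 + G.1 * shiftDeriv i F.1
      rw [shiftDeriv_eq_sum i F s hF, shiftDeriv_eq_sum i G s hG,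
        shiftDeriv_eq_sum i (F * G) s fun p hp => by simp [hF p hp, hG p hp],
        ← Subalgebra.coe_mul, ← Subalgebra.coe_mul, ← Subalgebra.coe_add, Finset.mul_sum,
        Finset.mul_sum, ← Finset.sum_add_distrib]
      congr 1
      refine Finset.sum_congr rfl fun p _ => ?_
      rw [Derivation.leibniz]
      simp only [smul_eq_mul]
      ring

@[simp]
theorem coe_shiftDerivation (i : Fin d) (F : nonlinearities d) :
    (shiftDerivation i F : JetFun d) = shiftDeriv i F.1 := rfl

theorem shiftDerivation_eq_sum (i : Fin d) (F : nonlinearities d) (s : Finset (Fin d → ℕ))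
    (hs : ∀ p, p ∉ s → pderivation (EdgeKind.kernel, p) F = 0) :
    shiftDerivation i F = ∑ p ∈ s, coordinate (EdgeKind.kernel, p + Pi.single i 1) *
      pderivation (EdgeKind.kernel, p) F :=
  Subtype.ext (shiftDeriv_eq_sum i F s hs)

/-- The commutator of `D_o` and `∂^i` is `D_{(𝓘, q)}` if `o = (𝓘, q + e_i)`, and zero otherwise. -/
theorem pderivation_shiftDerivation (o : EdgeType d) (i : Fin d) (F : nonlinearities d) :
    pderivation o (shiftDerivation i F) = shiftDerivation i (pderivation o F) ∨
    ∃ q : Fin d → ℕ, o = (EdgeKind.kernel, q + Pi.single i 1) ∧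
      pderivation o (shiftDerivation i F) = shiftDerivation i (pderivation o F) +
        pderivation (EdgeKind.kernel, q) F := by
  classical
  set s := (finite_pderivation_ne_zero F).toFinset
  have hF : ∀ p, p ∉ s → pderivation (EdgeKind.kernel, p) F = 0 := by
    intro p hp; simpa [s] using hp
  have hFo : ∀ p, p ∉ s → pderivation (EdgeKind.kernel, p) (pderivation o F) = 0 := by
    intro p hp; rw [pderivation_comm, hF p hp, map_zero]
  -- The commutator arises only when `D_o` hits one of the coefficients `Y_{(𝓘, p + e_i)}`; at most
  -- one `p` has this coefficient equal to `Y_o`.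
  have h1 : pderivation o (shiftDerivation i F) = shiftDerivation i (pderivation o F) +
      ∑ p ∈ s, pderivation (EdgeKind.kernel, p) F *
        pderivation o (coordinate (EdgeKind.kernel, p + Pi.single i 1)) := by
    rw [shiftDerivation_eq_sum i F s hF, shiftDerivation_eq_sum i _ s hFo, map_sum,
      ← Finset.sum_add_distrib]
    refine Finset.sum_congr rfl fun p _ => ?_
    rw [Derivation.leibniz, pderivation_comm]
    simp only [smul_eq_mul]
  by_cases ho : ∃ q : Fin d → ℕ, o = (EdgeKind.kernel, q + Pi.single i 1)
  · obtain ⟨q, rfl⟩ := ho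
    refine Or.inr ⟨q, rfl, ?_⟩
    rw [h1]
    congr 1
    rw [Finset.sum_eq_single q]
    · rw [pderivation_coordinate_self, mul_one]
    · intro p _ hp
      rw [pderivation_coordinate_of_ne, mul_zero]
      exact fun h => hp (add_right_cancel (Prod.mk.inj h).2)
    · intro hq
      rw [hF q hq, zero_mul]
  · refine Or.inl ?_
    rw [h1, Finset.sum_eq_zero, add_zero]
    intro p _
    rw [pderivation_coordinate_of_ne, mul_zero]
    rintro rfl
    exact ho ⟨p, rfl⟩

end RegTrees

namespace RegTrees

variable {d : ℕ}

/-! ### Iterated derivatives of products over the nodes of a tree -/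

theorem derivation_prod {A ι : Type*} [CommRing A] [Algebra ℝ A] [DecidableEq ι]
    (D : Derivation ℝ A A) (s : Finset ι) (f : ι → A) :
    D (∏ y ∈ s, f y) = ∑ y ∈ s, (∏ z ∈ s.erase y, f z) * D (f y) := by
  induction s using Finset.induction_on with
  | empty => simp
  | insert a s ha ih =>
    rw [Finset.prod_insert ha, Derivation.leibniz, ih, Finset.sum_insert ha,
      Finset.erase_insert ha, smul_eq_mul, smul_eq_mul, Finset.mul_sum, add_comm]
    congr 1
    refine Finset.sum_congr rfl fun y hy => ?_
    have hya : a ≠ y := fun h => ha (h ▸ hy)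
    rw [Finset.erase_insert_of_ne hya, Finset.prod_insert (by simp [ha]), mul_assoc]

/-- Leibniz rule modulo coefficients: only the shape of the terms is needed later, so spans replace
explicit combinatorial sums. -/
theorem derivation_prod_mem_span {A ι : Type*} [CommRing A] [Algebra ℝ A] [DecidableEq ι]
    (D : Derivation ℝ A A) (s : Finset ι) (f : ι → A) (V : Set A) (B : ι → Set A)
    (hB : ∀ y ∈ s, D (f y) ∈ Submodule.span ℝ (B y))
    (hV : ∀ y ∈ s, ∀ b ∈ B y, ∏ z ∈ s, Function.update f y b z ∈ V) :
    D (∏ y ∈ s, f y) ∈ Submodule.span ℝ V := by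
  rw [derivation_prod]
  refine Submodule.sum_mem _ fun y hy => ?_
  have h : Submodule.span ℝ (B y) ≤ (Submodule.span ℝ V).comap
      (LinearMap.mulLeft ℝ (∏ z ∈ s.erase y, f z)) := by
    rw [Submodule.span_le]
    intro b hb
    refine Submodule.subset_span ?_
    have := hV y hy b hb
    rw [Finset.prod_update_of_mem hy, ← Finset.erase_eq, mul_comm] at this
    exact this
  exact h (hB y hy)

/-! ### Words of derivatives -/

/-- The composition of the derivatives `D_o`, `o ∈ E`. -/
def pderivWord (E : List (EdgeType d)) : nonlinearities d →ₗ[ℝ] nonlinearities d :=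
  E.foldr (fun o L => (pderivation o : nonlinearities d →ₗ[ℝ] nonlinearities d) ∘ₗ L) LinearMap.id

/-- The composition of the operators `∂^i`, `i ∈ w`. -/
def shiftWord (w : List (Fin d)) : nonlinearities d →ₗ[ℝ] nonlinearities d :=
  w.foldr (fun i L => (shiftDerivation i : nonlinearities d →ₗ[ℝ] nonlinearities d) ∘ₗ L)
    LinearMap.id

theorem pderivWord_cons (o : EdgeType d) (E : List (EdgeType d)) (F : nonlinearities d) :
    pderivWord (o :: E) F = pderivation o (pderivWord E F) := rfl

theorem shiftWord_cons (i : Fin d) (w : List (Fin d)) (F : nonlinearities d) :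
    shiftWord (i :: w) F = shiftDerivation i (shiftWord w F) := rfl

theorem shiftWord_append (w w' : List (Fin d)) (F : nonlinearities d) :
    shiftWord (w ++ w') F = shiftWord w (shiftWord w' F) := by
  induction w with
  | nil => rfl
  | cons i w ih => rw [List.cons_append, shiftWord_cons, ih, shiftWord_cons]

theorem coe_pderivWord (E : List (EdgeType d)) (F : nonlinearities d) :
    (pderivWord E F : JetFun d) = pderivs E F.1 := by
  induction E with
  | nil => rfl
  | cons o E ih => rw [pderivWord_cons, coe_pderivation, ih]; rfl

/-- The word with letters `i` repeated `k i` times. -/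
def wordOf (k : Fin d → ℕ) : List (Fin d) :=
  (List.finRange d).flatMap fun i => List.replicate (k i) i

/-- The number of occurrences of the letters in a word. -/
def wordCount (w : List (Fin d)) : Fin d → ℕ := fun i => w.count i

theorem wordCount_cons (i : Fin d) (w : List (Fin d)) :
    wordCount (i :: w) = wordCount w + Pi.single i 1 := by
  ext j
  by_cases h : i = j
  · subst h; simp [wordCount]
  · simp [wordCount, h, Ne.symm h]

theorem wordCount_wordOf (k : Fin d → ℕ) : wordCount (wordOf k) = k := by
  ext j
  simp only [wordCount, wordOf, List.count_flatMap, Function.comp_def, List.count_replicate]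
  rw [← List.ofFn_eq_map, List.sum_ofFn]
  simp

theorem coe_shiftWord_replicate (n : ℕ) (i : Fin d) (F : nonlinearities d) :
    (shiftWord (List.replicate n i) F : JetFun d) = (shiftDeriv i)^[n] F.1 := by
  induction n with
  | zero => rfl
  | succ n ih =>
    rw [List.replicate_succ, shiftWord_cons, coe_shiftDerivation, ih,
      Function.iterate_succ_apply']

theorem coe_shiftWord_wordOf (k : Fin d → ℕ) (F : nonlinearities d) :
    (shiftWord (wordOf k) F : JetFun d) = shiftDerivs k F.1 := by
  unfold wordOf shiftDerivs
  induction List.finRange d with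
  | nil => rfl
  | cons i l ih =>
    rw [List.flatMap_cons, shiftWord_append, coe_shiftWord_replicate, ih, List.foldr_cons]

/-- `D_o` is moved to the right past the letters of `w`; by the commutator formula each letter is
either kept, and then belongs to `w'`, or absorbed, and then contributes to the lowering `e`. -/
theorem pderivation_shiftWord_mem_span (o : EdgeType d) (w : List (Fin d))
    (G : nonlinearities d) :
    pderivation o (shiftWord w G) ∈ Submodule.span ℝ {X | ∃ w' o' e,
      X = shiftWord w' (pderivation o' G) ∧ wordCount w' + e = wordCount w ∧
        (o'.1, o'.2 + e) = o} := by
  induction w generalizing o with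
  | nil =>
    refine Submodule.subset_span ⟨[], o, 0, rfl, by simp, by simp⟩
  | cons i w ih =>
    have h1 : shiftDerivation i (pderivation o (shiftWord w G)) ∈ Submodule.span ℝ {X | ∃ w' o' e,
        X = shiftWord w' (pderivation o' G) ∧ wordCount w' + e = wordCount (i :: w) ∧
        (o'.1, o'.2 + e) = o} := by
      have := Submodule.mem_map_of_mem
        (f := (shiftDerivation i : nonlinearities d →ₗ[ℝ] nonlinearities d)) (ih o)
      rw [Submodule.map_span] at this
      refine Submodule.span_mono ?_ this
      rintro _ ⟨_, ⟨w', o', e, rfl, hw, ho⟩, rfl⟩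
      refine ⟨i :: w', o', e, rfl, ?_, ho⟩
      rw [wordCount_cons, wordCount_cons, ← hw]
      abel
    rw [shiftWord_cons]
    rcases pderivation_shiftDerivation o i (shiftWord w G) with h | ⟨q, rfl, h⟩
    · rw [h]
      exact h1
    · rw [h]
      -- In the commutator term the letter `i` is absorbed: the derivative continues with index `q`,
      -- and the lowering gains `e_i`.
      refine Submodule.add_mem _ h1 (Submodule.span_mono ?_ (ih (EdgeKind.kernel, q)))
      rintro _ ⟨w', o', e, rfl, hw, ho⟩
      refine ⟨w', o', e + Pi.single i 1, rfl, ?_, ?_⟩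
      · rw [wordCount_cons, ← hw]
        abel
      · rw [Prod.mk.injEq] at ho ⊢
        exact ⟨ho.1, by rw [← ho.2]; abel⟩

/-! ### Distribution of derivatives over the nodes -/

open Classical in
/-- The product over the non-noise nodes of the functions `∂^{w y} D_{E y} F`. -/
def nodeProd (σ : DecTree d) (F : nonlinearities d) (w : σ.Node → List (Fin d))
    (E : σ.Node → List (EdgeType d)) : nonlinearities d :=
  ∏ y ∈ Finset.univ.filter (fun y => ¬ σ.IsNoiseNode y), shiftWord (w y) (pderivWord (E y) F)

/-- The elements of `N` are attached to non-noise nodes of `σ`, the entry `(y, e, o)` of `W`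
standing for an edge whose type `o` was lowered by `e` and which is attached to `y`. The polynomial
decoration of `σ` is the sum of `nA` and of the lowerings, and `extra` adds up to `k`. -/
structure IsSpread (σ : DecTree d) (k : Fin d → ℕ) (N : Multiset (EdgeType d))
    (W : Multiset (σ.Node × (Fin d → ℕ) × EdgeType d)) (nA extra : σ.Node → Fin d → ℕ) :
    Prop where
  not_noise : ∀ t ∈ W, ¬ σ.IsNoiseNode t.1
  extra_noise : ∀ y, σ.IsNoiseNode y → extra y = 0
  map_eq : W.map (fun t => (t.2.2.1, t.2.2.2 + t.2.1)) = N
  sum_extra : ∑ y, extra y = k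
  poly_eq : ∀ y, nA y + ((W.filter fun t => t.1 = y).map fun t => t.2.1).sum = σ.poly y

/-- The words `w` and `E` record the decorations of the nodes that result from a spread. -/
structure IsConfig (σ : DecTree d) (k : Fin d → ℕ) (N : Multiset (EdgeType d))
    (W : Multiset (σ.Node × (Fin d → ℕ) × EdgeType d)) (nA extra : σ.Node → Fin d → ℕ)
    (w : σ.Node → List (Fin d)) (E : σ.Node → List (EdgeType d)) : Prop
    extends IsSpread σ k N W nA extra where
  count_eq : ∀ y, wordCount (w y) = nA y + extra y
  edges_eq : ∀ y, (E y : Multiset (EdgeType d)) =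
    σ.outEdges y + (W.filter fun t => t.1 = y).map fun t => t.2.2

/-- The products `nodeProd` over all configurations. -/
def configSet (σ : DecTree d) (F : nonlinearities d) (k : Fin d → ℕ)
    (N : Multiset (EdgeType d)) : Set (nonlinearities d) :=
  {X | ∃ W nA extra w E, IsConfig σ k N W nA extra w E ∧ X = nodeProd σ F w E}

theorem isConfig_initial (σ : DecTree d) :
    IsConfig σ 0 0 0 σ.poly 0 (fun y => wordOf (σ.poly y)) (fun y => (σ.outEdges y).toList) where
  not_noise := by simp
  extra_noise := by simp
  map_eq := by simp
  sum_extra := by simp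
  poly_eq := by simp
  count_eq := by simp [wordCount_wordOf]
  edges_eq := by simp

/-- One more derivative `D_o` acts on the factor of `y`. The case `k = 0` suffices because `∂^k`
acts after all `D_o`; this is also why lowerings draw on the decoration of `σ` alone and never on
`extra`. -/
theorem IsConfig.attach {σ : DecTree d} {N W nA extra w E} (h : IsConfig σ 0 N W nA extra w E)
    {y : σ.Node} (hy : ¬ σ.IsNoiseNode y) {w' : List (Fin d)} {e : Fin d → ℕ} {o' o : EdgeType d}
    (hw : wordCount w' + e = wordCount (w y)) (ho : (o'.1, o'.2 + e) = o) :
    IsConfig σ 0 (o ::ₘ N) ((y, e, o') ::ₘ W) (Function.update nA y (wordCount w')) extra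
      (Function.update w y w') (Function.update E y (o' :: E y)) := by
  -- A vanishing sum in `ℕ^d` has vanishing terms, so the words `w` still count exactly `nA`.
  have hex : ∀ z, extra z = 0 := by
    intro z
    have h1 := h.sum_extra
    exact (Finset.sum_eq_zero_iff.mp h1) z (Finset.mem_univ z)
  refine ⟨⟨?_, h.extra_noise, ?_, h.sum_extra, ?_⟩, ?_, ?_⟩
  · intro t ht
    rcases Multiset.mem_cons.mp ht with rfl | ht
    · exact hy
    · exact h.not_noise t ht
  · rw [Multiset.map_cons, h.map_eq, ← ho]
  · intro z
    by_cases hz : z = y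
    · subst hz
      have := h.poly_eq z
      have h2 := h.count_eq z
      rw [hex, add_zero] at h2
      rw [Function.update_self, Multiset.filter_cons_of_pos
        (p := fun t : σ.Node × (Fin d → ℕ) × EdgeType d => t.1 = z) W rfl, Multiset.map_cons,
        Multiset.sum_cons, ← this, ← h2, ← hw, add_assoc]
    · rw [Function.update_of_ne hz, Multiset.filter_cons_of_neg _ (by simpa using Ne.symm hz)]
      exact h.poly_eq z
  · intro z
    by_cases hz : z = y
    · subst hz
      simp [hex]
    · rw [Function.update_of_ne hz, Function.update_of_ne hz]
      exact h.count_eq z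
  · intro z
    by_cases hz : z = y
    · subst hz
      rw [Function.update_self, Multiset.filter_cons_of_pos
        (p := fun t : σ.Node × (Fin d → ℕ) × EdgeType d => t.1 = z) W rfl, Multiset.map_cons,
        ← Multiset.cons_coe, h.edges_eq, Multiset.add_cons]
    · rw [Function.update_of_ne hz, Multiset.filter_cons_of_neg _ (by simpa using Ne.symm hz)]
      exact h.edges_eq z

theorem IsConfig.shift {σ : DecTree d} {k N W nA extra w E} (h : IsConfig σ k N W nA extra w E)
    {y : σ.Node} (hy : ¬ σ.IsNoiseNode y) (i : Fin d) :
    IsConfig σ (k + Pi.single i 1) N W nA (extra + Pi.single y (Pi.single i 1))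
      (Function.update w y (i :: w y)) E := by
  refine ⟨⟨h.not_noise, ?_, h.map_eq, ?_, h.poly_eq⟩, ?_, h.edges_eq⟩
  · intro z hz
    have hzy : z ≠ y := fun e => hy (e ▸ hz)
    simp [h.extra_noise z hz, hzy]
  · simp only [Pi.add_apply, Finset.sum_add_distrib, h.sum_extra]
    rw [Finset.sum_pi_single']
    simp
  · intro z
    by_cases hz : z = y
    · subst hz
      rw [Function.update_self, wordCount_cons, h.count_eq]
      simp [add_assoc]
    · rw [Function.update_of_ne hz, h.count_eq]
      simp [hz]

theorem pderivation_mem_span_configSet (σ : DecTree d) (F : nonlinearities d)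
    (N : Multiset (EdgeType d)) (o : EdgeType d) {X : nonlinearities d}
    (hX : X ∈ Submodule.span ℝ (configSet σ F 0 N)) :
    pderivation o X ∈ Submodule.span ℝ (configSet σ F 0 (o ::ₘ N)) := by
  classical
  refine (Submodule.span_le (p := (Submodule.span ℝ (configSet σ F 0 (o ::ₘ N))).comap
    (pderivation o : nonlinearities d →ₗ[ℝ] nonlinearities d))).mpr ?_ hX
  rintro _ ⟨W, nA, extra, w, E, h, rfl⟩
  refine derivation_prod_mem_span _ _ _ _ _
    (fun y _ => pderivation_shiftWord_mem_span o (w y) (pderivWord (E y) F)) ?_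
  rintro y hy _ ⟨w', o', e, rfl, hw, ho⟩
  refine ⟨_, _, _, _, _, h.attach (Finset.mem_filter.mp hy).2 hw ho, ?_⟩
  unfold nodeProd
  refine Finset.prod_congr (by congr!) fun z _ => ?_
  by_cases hz : z = y
  · subst hz; simp [pderivWord_cons]
  · simp [hz]

theorem shiftDerivation_mem_span_configSet (σ : DecTree d) (F : nonlinearities d) (k : Fin d → ℕ)
    (N : Multiset (EdgeType d)) (i : Fin d) {X : nonlinearities d}
    (hX : X ∈ Submodule.span ℝ (configSet σ F k N)) :
    shiftDerivation i X ∈ Submodule.span ℝ (configSet σ F (k + Pi.single i 1) N) := by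
  classical
  refine (Submodule.span_le (p := (Submodule.span ℝ (configSet σ F (k + Pi.single i 1) N)).comap
    (shiftDerivation i : nonlinearities d →ₗ[ℝ] nonlinearities d))).mpr ?_ hX
  rintro _ ⟨W, nA, extra, w, E, h, rfl⟩
  refine derivation_prod_mem_span _ _ _ _
    (fun y => {shiftDerivation i (shiftWord (w y) (pderivWord (E y) F))})
    (fun y _ => Submodule.subset_span rfl) ?_
  rintro y hy _ rfl
  refine ⟨_, _, _, _, _, h.shift (Finset.mem_filter.mp hy).2 i, ?_⟩
  unfold nodeProd
  refine Finset.prod_congr (by congr!) fun z _ => ?_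
  by_cases hz : z = y
  · subst hz; simp [shiftWord_cons]
  · simp [hz]

theorem iterated_mem_span_configSet (σ : DecTree d) (F : nonlinearities d) (w : List (Fin d))
    (E : List (EdgeType d)) :
    shiftWord w (pderivWord E (nodeProd σ F (fun y => wordOf (σ.poly y))
      fun y => (σ.outEdges y).toList)) ∈ Submodule.span ℝ (configSet σ F (wordCount w) E) := by
  induction w with
  | nil =>
    induction E with
    | nil => exact Submodule.subset_span ⟨_, _, _, _, _, isConfig_initial σ, rfl⟩
    | cons o E ih => exact pderivation_mem_span_configSet σ F E o ih
  | cons i w ih =>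
    rw [wordCount_cons]
    exact shiftDerivation_mem_span_configSet σ F _ _ i ih

/-- If a derivative of `nodeProd` does not vanish, then some configuration conforms to the rule. -/
theorem exists_isSpread {R : Set (Multiset (EdgeType d))} (σ : DecTree d) (F : nonlinearities d)
    (hF : Obeys F.1 R) (w : List (Fin d)) (E : List (EdgeType d))
    (h : shiftWord w (pderivWord E (nodeProd σ F (fun y => wordOf (σ.poly y))
      fun y => (σ.outEdges y).toList)) ≠ 0) :
    ∃ W nA extra, IsSpread σ (wordCount w) E W nA extra ∧ ∀ y, ¬ σ.IsNoiseNode y →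
      σ.outEdges y + (W.filter fun t => t.1 = y).map (fun t => t.2.2) ∈ R := by
  by_contra hcon
  apply h
  have hmem := iterated_mem_span_configSet σ F w E
  -- If every configuration breaks the rule at some node, the factor of that node vanishes because
  -- `F` obeys `R`, and so does the whole span.
  have hz : configSet σ F (wordCount w) E ⊆ {0} := by
    rintro _ ⟨W, nA, extra, w', E', hc, rfl⟩
    by_contra hne
    refine hcon ⟨W, nA, extra, hc.toIsSpread, fun y hy => ?_⟩
    by_contra hR
    apply hne
    rw [← hc.edges_eq] at hR
    refine Finset.prod_eq_zero (i := y) (by simpa using hy) ?_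
    have : pderivWord (E' y) F = 0 := Subtype.ext (by rw [coe_pderivWord, hF _ hR]; rfl)
    rw [this, map_zero]
  have := Submodule.span_mono hz hmem
  simpa using this

end RegTrees

namespace RegTrees

variable {d : ℕ}

/-! ### Gluing of trees into the nodes of a tree -/

theorem DecTree.mem_children {τ : DecTree d} {x v : τ.Node} :
    v ∈ τ.children x ↔ v ≠ τ.root ∧ τ.parent v = x := by
  simp [DecTree.children]

/-- Data to replace every node `x` of `τ` by a tree `piece x`, in such a way that `τ` is recovered
by contracting the pieces at the `active` nodes. The edge `v` of `τ` is attached to the node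
`attach (parent v) v`, with its type lowered by `lower v`; the polynomial decoration of `x` is
distributed according to `extra x`. -/
structure Gluing (δ : DegreeMap d) (R : Set (Multiset (EdgeType d))) (τ : DecTree d) where
  piece : τ.Node → DecTree d
  active : τ.Node → Prop
  attach : ∀ x, τ.Node → (piece x).Node
  lower : τ.Node → Fin d → ℕ
  nA : ∀ x, (piece x).Node → Fin d → ℕ
  extra : ∀ x, (piece x).Node → Fin d → ℕ
  not_active_of_noise : ∀ x, τ.IsNoiseNode x → ¬ active x
  subsingleton : ∀ x, ¬ active x → Subsingleton (piece x).Node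
  nA_eq_zero : ∀ x, ¬ active x → ∀ y, nA x y = 0
  lower_eq_zero : ∀ v, v ≠ τ.root → ¬ active (τ.parent v) → lower v = 0
  piece_mem : ∀ x, active x → (piece x).toClass ∈ negTrees δ R
  piece_ext : ∀ x y, (piece x).ext y = 0
  degree_eq : ∀ x, (piece x).degree δ = τ.ext x
  poly_eq : ∀ x y, nA x y + ∑ v ∈ (τ.children x).filter (fun v => attach x v = y), lower v =
    (piece x).poly y
  attach_not_noise : ∀ x, ∀ v ∈ τ.children x, ¬ (piece x).IsNoiseNode (attach x v)
  extra_noise : ∀ x y, (piece x).IsNoiseNode y → extra x y = 0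
  sum_extra : ∀ x, ∑ y, extra x y = τ.poly x
  lower_le : ∀ v, v ≠ τ.root → lower v ≤ (τ.edge v).2
  mem_rule : ∀ x y, (piece x).outEdges y +
    ((τ.children x).filter fun v => attach x v = y).val.map
      (fun v => ((τ.edge v).1, (τ.edge v).2 - lower v)) ∈ R

namespace Gluing

variable {δ : DegreeMap d} {R : Set (Multiset (EdgeType d))} {τ : DecTree d} (Γ : Gluing δ R τ)

/-- The nodes of the glued tree. -/
abbrev GNode : Type := Σ x : τ.Node, (Γ.piece x).Node

/-- The root of the piece at `x`. -/
def base (x : τ.Node) : Γ.GNode := ⟨x, (Γ.piece x).root⟩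

open Classical in
/-- The parent in the glued tree. -/
def gparent (p : Γ.GNode) : Γ.GNode :=
  if p.2 = (Γ.piece p.1).root then
    if p.1 = τ.root then p else ⟨τ.parent p.1, Γ.attach (τ.parent p.1) p.1⟩
  else ⟨p.1, (Γ.piece p.1).parent p.2⟩

theorem gparent_of_ne {x : τ.Node} {y : (Γ.piece x).Node} (h : y ≠ (Γ.piece x).root) :
    Γ.gparent ⟨x, y⟩ = ⟨x, (Γ.piece x).parent y⟩ := by
  simp [gparent, h]

theorem gparent_base {x : τ.Node} (h : x ≠ τ.root) :
    Γ.gparent (Γ.base x) = ⟨τ.parent x, Γ.attach (τ.parent x) x⟩ := by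
  simp [gparent, base, h]

theorem gparent_base_root : Γ.gparent (Γ.base τ.root) = Γ.base τ.root := by
  simp [gparent, base]

theorem base_injective : Function.Injective Γ.base := fun _ _ h => (Sigma.mk.inj h).1

theorem mk_ne_base {x x' : τ.Node} {y : (Γ.piece x).Node} (h : y ≠ (Γ.piece x).root) :
    (⟨x, y⟩ : Γ.GNode) ≠ Γ.base x' := by
  intro e
  obtain ⟨rfl, e2⟩ := Sigma.mk.inj e
  exact h (eq_of_heq e2)

theorem greaches_root (p : Γ.GNode) : ∃ k : ℕ, Γ.gparent^[k] p = Γ.base τ.root := by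
  obtain ⟨x, y⟩ := p
  obtain ⟨n, hn⟩ := τ.reaches_root x
  induction n generalizing x with
  | zero =>
    obtain rfl : x = τ.root := hn
    obtain ⟨m, hm⟩ := (Γ.piece τ.root).reaches_root y
    induction m generalizing y with
    | zero =>
      obtain rfl : y = _ := hm
      exact ⟨0, rfl⟩
    | succ m ih =>
      by_cases h : y = (Γ.piece τ.root).root
      · subst h
        exact ⟨0, rfl⟩
      · obtain ⟨k, hk⟩ := ih _ hm
        exact ⟨k + 1, by rw [Function.iterate_succ_apply, gparent_of_ne _ h]; exact hk⟩
  | succ n ihn =>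
    obtain ⟨m, hm⟩ := (Γ.piece x).reaches_root y
    -- Descent has two scales: inside a piece to its root, then along an edge of `τ` into the piece
    -- of the parent.
    have hbase : ∃ k : ℕ, Γ.gparent^[k] (Γ.base x) = Γ.base τ.root := by
      by_cases h : x = τ.root
      · subst h
        exact ⟨0, rfl⟩
      · obtain ⟨k, hk⟩ := ihn (τ.parent x) (Γ.attach (τ.parent x) x) hn
        exact ⟨k + 1, by rw [Function.iterate_succ_apply, gparent_base _ h]; exact hk⟩
    induction m generalizing y with
    | zero =>
      obtain rfl : y = _ := hm
      exact hbase
    | succ m ih =>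
      by_cases h : y = (Γ.piece x).root
      · subst h
        exact hbase
      · obtain ⟨k, hk⟩ := ih _ hm
        exact ⟨k + 1, by rw [Function.iterate_succ_apply, gparent_of_ne _ h]; exact hk⟩

/-- The edges leaving a glued node are those of its piece and those of `τ` attached to it; this
gives the description of `children` used for the rule and for `piE`. -/
theorem gparent_eq_iff {p : Γ.GNode} {x : τ.Node} {y : (Γ.piece x).Node} :
    (p ≠ Γ.base τ.root ∧ Γ.gparent p = ⟨x, y⟩) ↔
      (∃ z ∈ (Γ.piece x).children y, p = ⟨x, z⟩) ∨
      ∃ v ∈ (τ.children x).filter (fun v => Γ.attach x v = y), p = Γ.base v := by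
  constructor
  · rintro ⟨hp, h⟩
    obtain ⟨x', z⟩ := p
    by_cases hz : z = (Γ.piece x').root
    · subst hz
      have hx' : x' ≠ τ.root := by rintro rfl; exact hp rfl
      rw [show (⟨x', (Γ.piece x').root⟩ : Γ.GNode) = Γ.base x' from rfl, gparent_base _ hx'] at h
      obtain ⟨rfl, h2⟩ := Sigma.mk.inj h
      refine Or.inr ⟨x', ?_, rfl⟩
      rw [Finset.mem_filter, DecTree.mem_children]
      exact ⟨⟨hx', rfl⟩, eq_of_heq h2⟩
    · rw [gparent_of_ne _ hz] at h
      obtain ⟨rfl, h2⟩ := Sigma.mk.inj h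
      exact Or.inl ⟨z, DecTree.mem_children.mpr ⟨hz, eq_of_heq h2⟩, rfl⟩
  · rintro (⟨z, hz, rfl⟩ | ⟨v, hv, rfl⟩)
    · obtain ⟨h1, h2⟩ := DecTree.mem_children.mp hz
      exact ⟨Γ.mk_ne_base h1, by rw [gparent_of_ne _ h1, h2]⟩
    · rw [Finset.mem_filter, DecTree.mem_children] at hv
      obtain ⟨⟨h1, rfl⟩, rfl⟩ := hv
      exact ⟨fun h => h1 (Γ.base_injective h), Γ.gparent_base h1⟩

open Classical in
/-- The edge decoration of the glued tree. -/
def gedge (p : Γ.GNode) : EdgeType d :=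
  if p.2 = (Γ.piece p.1).root then ((τ.edge p.1).1, (τ.edge p.1).2 - Γ.lower p.1)
  else (Γ.piece p.1).edge p.2

theorem gedge_base (x : τ.Node) :
    Γ.gedge (Γ.base x) = ((τ.edge x).1, (τ.edge x).2 - Γ.lower x) := by
  simp [gedge, base]

theorem gedge_of_ne {x : τ.Node} {y : (Γ.piece x).Node} (h : y ≠ (Γ.piece x).root) :
    Γ.gedge ⟨x, y⟩ = (Γ.piece x).edge y := by
  simp [gedge, h]

theorem nA_le (x : τ.Node) (y : (Γ.piece x).Node) : Γ.nA x y ≤ (Γ.piece x).poly y := by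
  rw [← Γ.poly_eq]
  exact le_self_add

theorem extra_eq_zero_of_noise {x : τ.Node} (h : τ.poly x = 0) (y : (Γ.piece x).Node) :
    Γ.extra x y = 0 := by
  have := Γ.sum_extra x
  rw [h] at this
  exact Finset.sum_eq_zero_iff.mp this y (Finset.mem_univ y)

/-- The glued tree. -/
def glue : DecTree d where
  Node := Γ.GNode
  fintypeNode := inferInstance
  root := Γ.base τ.root
  parent := Γ.gparent
  parent_root := Γ.gparent_base_root
  reaches_root := Γ.greaches_root
  poly := fun p => Γ.nA p.1 p.2 + Γ.extra p.1 p.2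
  ext := fun _ => 0
  edge := Γ.gedge
  noise_leaf := by
    rintro ⟨x, y⟩ hp hn
    have hchild : ∀ q, q ≠ Γ.base τ.root → Γ.gparent q = ⟨x, y⟩ →
        (∃ z, z ∈ (Γ.piece x).children y) ∨ ∃ v, v ∈ τ.children x ∧ Γ.attach x v = y := by
      intro q h1 h2
      rcases Γ.gparent_eq_iff.mp ⟨h1, h2⟩ with ⟨z, hz, _⟩ | ⟨v, hv, _⟩
      · exact Or.inl ⟨z, hz⟩
      · exact Or.inr ⟨v, Finset.mem_filter.mp hv⟩
    by_cases hy : y = (Γ.piece x).root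
    · subst hy
      have hx : x ≠ τ.root := by rintro rfl; exact hp rfl
      have hn' : (τ.edge x).1 = EdgeKind.noise := by
        rwa [show (⟨x, (Γ.piece x).root⟩ : Γ.GNode) = Γ.base x from rfl, gedge_base] at hn
      have hna := Γ.not_active_of_noise x ⟨hx, hn'⟩
      obtain ⟨h1, h2, -⟩ := τ.noise_leaf x hx hn'
      refine ⟨fun q hq h => ?_, ?_, rfl⟩
      · rcases hchild q hq h with ⟨z, hz⟩ | ⟨v, hv, -⟩
        · have := Γ.subsingleton x hna
          exact (DecTree.mem_children.mp hz).1 (Subsingleton.elim _ _)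
        · exact h1 v (DecTree.mem_children.mp hv).1 (DecTree.mem_children.mp hv).2
      · rw [Γ.nA_eq_zero x hna, Γ.extra_eq_zero_of_noise h2, add_zero]
    · rw [gedge_of_ne _ hy] at hn
      obtain ⟨h1, h2, -⟩ := (Γ.piece x).noise_leaf y hy hn
      refine ⟨fun q hq h => ?_, ?_, rfl⟩
      · rcases hchild q hq h with ⟨z, hz⟩ | ⟨v, hv, rfl⟩
        · exact h1 z (DecTree.mem_children.mp hz).1 (DecTree.mem_children.mp hz).2
        · exact Γ.attach_not_noise x v hv ⟨hy, hn⟩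
      · have h3 := Γ.nA_le x y
        rw [h2] at h3
        rw [le_antisymm h3 (fun _ => Nat.zero_le _), Γ.extra_noise x y ⟨hy, hn⟩, add_zero]

/-- The nodes of the glued tree. -/
def gmk (x : τ.Node) (y : (Γ.piece x).Node) : Γ.glue.Node := (⟨x, y⟩ : Γ.GNode)

/-- The embedding of a piece. -/
def pieceEmb (x : τ.Node) : (Γ.piece x).Node ↪ Γ.glue.Node :=
  ⟨fun y => (⟨x, y⟩ : Γ.GNode), fun _ _ h => eq_of_heq (Sigma.mk.inj h).2⟩

/-- The root of the piece at `x` as a node of the glued tree. -/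
abbrev gbase (x : τ.Node) : Γ.glue.Node := Γ.base x

/-- The embedding of the nodes of `τ` as roots of the pieces. -/
def baseEmb : τ.Node ↪ Γ.glue.Node := ⟨Γ.base, Γ.base_injective⟩

theorem children_glue (x : τ.Node) (y : (Γ.piece x).Node) :
    ∃ h, Γ.glue.children (Γ.gmk x y) = (((Γ.piece x).children y).map (Γ.pieceEmb x)).disjUnion
      (((τ.children x).filter fun v => Γ.attach x v = y).map Γ.baseEmb) h := by
  refine ⟨?_, ?_⟩
  · rw [Finset.disjoint_left]
    intro p hp hq
    obtain ⟨z, hz, rfl⟩ := Finset.mem_map.mp hp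
    obtain ⟨v, -, h⟩ := Finset.mem_map.mp hq
    exact Γ.mk_ne_base (x' := v) (DecTree.mem_children.mp hz).1 h.symm
  · ext p
    rw [Finset.mem_disjUnion, Finset.mem_map, Finset.mem_map]
    refine (DecTree.mem_children (τ := Γ.glue)).trans ?_
    refine (Γ.gparent_eq_iff (p := p)).trans (or_congr ?_ ?_)
    · exact ⟨fun ⟨z, hz, h⟩ => ⟨z, hz, h.symm⟩, fun ⟨z, hz, h⟩ => ⟨z, hz, h.symm⟩⟩
    · exact ⟨fun ⟨z, hz, h⟩ => ⟨z, hz, h.symm⟩, fun ⟨z, hz, h⟩ => ⟨z, hz, h.symm⟩⟩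

/-- By the description of the children, the field `mem_rule` is conformity of the glued tree node by
node. -/
theorem conforms_glue : Γ.glue.Conforms R := by
  refine ⟨fun _ => rfl, ?_⟩
  rintro ⟨x, y⟩
  obtain ⟨h, e⟩ := Γ.children_glue x y
  have hR := Γ.mem_rule x y
  change (Γ.glue.children (Γ.gmk x y)).val.map Γ.glue.edge ∈ R
  rw [e, Finset.disjUnion_val, Multiset.map_add, Finset.map_val, Finset.map_val,
    Multiset.map_map, Multiset.map_map]
  convert hR using 2
  · refine Multiset.map_congr rfl fun z hz => ?_
    exact Γ.gedge_of_ne (DecTree.mem_children.mp hz).1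
  · exact Multiset.map_congr rfl fun v _ => Γ.gedge_base v

open Classical in
/-- The extraction of all active pieces from the glued tree. -/
def extraction : Extraction Γ.glue where
  nodes := Finset.univ.filter fun p => Γ.active p.1
  edges := Finset.univ.filter fun p => p.2 ≠ (Γ.piece p.1).root
  edges_ne_root := by
    rintro ⟨x, y⟩ h
    exact Γ.mk_ne_base (Finset.mem_filter.mp h).2
  edges_upper := by
    rintro ⟨x, y⟩ h
    have h2 := (Finset.mem_filter.mp h).2
    refine Finset.mem_filter.mpr ⟨Finset.mem_univ _, ?_⟩
    by_contra hna
    have := Γ.subsingleton x hna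
    exact h2 (Subsingleton.elim _ _)
  edges_lower := by
    rintro ⟨x, y⟩ h
    have h2 : y ≠ (Γ.piece x).root := (Finset.mem_filter.mp h).2
    refine Finset.mem_filter.mpr ⟨Finset.mem_univ _, ?_⟩
    rw [show Γ.glue.parent ⟨x, y⟩ = ⟨x, (Γ.piece x).parent y⟩ from Γ.gparent_of_ne h2]
    by_contra hna
    have := Γ.subsingleton x hna
    exact h2 (Subsingleton.elim _ _)
  nA := fun p => Γ.nA p.1 p.2
  nA_le := fun p => le_self_add
  nA_support := by
    rintro ⟨x, y⟩ h
    exact Γ.nA_eq_zero x (fun ha => h (Finset.mem_filter.mpr ⟨Finset.mem_univ _, ha⟩)) y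
  -- The root of `τ` is excluded because no edge ends there, so that `lower` is unconstrained at it,
  -- whereas `eA_support` demands zero.
  eA := fun p => if p.2 = (Γ.piece p.1).root ∧ p.1 ≠ τ.root then Γ.lower p.1 else 0
  eA_support := by
    rintro ⟨x, y⟩ h
    refine (ite_eq_right_iff).mpr ?_
    rintro ⟨hy, hx⟩
    have hy' : y = (Γ.piece x).root := hy
    subst hy'
    by_contra hl
    apply h
    refine ⟨fun e => hx (Γ.base_injective e), fun he => (Finset.mem_filter.mp he).2 rfl, ?_⟩
    rw [show Γ.glue.parent ⟨x, (Γ.piece x).root⟩ = ⟨τ.parent x, _⟩ from Γ.gparent_base hx]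
    refine Finset.mem_filter.mpr ⟨Finset.mem_univ _, ?_⟩
    by_contra hna
    exact hl (Γ.lower_eq_zero x hx hna)

/-! ### Contraction of the glued tree -/

theorem mem_edges_iff {x : τ.Node} {y : (Γ.piece x).Node} :
    Γ.gmk x y ∈ Γ.extraction.edges ↔ y ≠ (Γ.piece x).root :=
  Finset.mem_filter.trans (and_iff_right (Finset.mem_univ _))

theorem base_not_mem_edges (x : τ.Node) : Γ.gbase x ∉ Γ.extraction.edges :=
  fun h => Γ.mem_edges_iff.mp h rfl

theorem top_mk (x : τ.Node) (y : (Γ.piece x).Node) :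
    Γ.extraction.top (Γ.gmk x y) = Γ.gbase x := by
  obtain ⟨m, hm⟩ := (Γ.piece x).reaches_root y
  induction m generalizing y with
  | zero =>
    obtain rfl : y = _ := hm
    exact Γ.extraction.top_of_not_mem (Γ.base_not_mem_edges x)
  | succ m ih =>
    by_cases h : y = (Γ.piece x).root
    · subst h
      exact Γ.extraction.top_of_not_mem (Γ.base_not_mem_edges x)
    · rw [Γ.extraction.top_of_mem (Γ.mem_edges_iff.mpr h),
        show Γ.glue.parent (Γ.gmk x y) = _ from Γ.gparent_of_ne h]
      exact ih _ hm

theorem top_eq_base_iff (p : Γ.glue.Node) (x : τ.Node) :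
    Γ.extraction.top p = Γ.gbase x ↔ ∃ y, Γ.pieceEmb x y = p := by
  constructor
  · obtain ⟨x', y⟩ := p
    intro h
    obtain rfl := Γ.base_injective ((Γ.top_mk x' y).symm.trans h)
    exact ⟨y, rfl⟩
  · rintro ⟨y, rfl⟩
    exact Γ.top_mk x y

theorem filter_top (x : τ.Node) :
    (Finset.univ.filter fun p => Γ.extraction.top p = Γ.gbase x) =
      Finset.univ.map (Γ.pieceEmb x) := by
  ext p
  rw [Finset.mem_filter, top_eq_base_iff, Finset.mem_map]
  simp

theorem filter_edges_top (x : τ.Node) :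
    (Γ.extraction.edges.filter fun p => Γ.extraction.top p = Γ.gbase x) =
      (Finset.univ.filter fun y => y ≠ (Γ.piece x).root).map (Γ.pieceEmb x) := by
  ext p
  rw [Finset.mem_filter, top_eq_base_iff, Finset.mem_map]
  constructor
  · rintro ⟨h, y, rfl⟩
    exact ⟨y, Finset.mem_filter.mpr ⟨Finset.mem_univ _, Γ.mem_edges_iff.mp h⟩, rfl⟩
  · rintro ⟨y, hy, rfl⟩
    exact ⟨Γ.mem_edges_iff.mpr (Finset.mem_filter.mp hy).2, y, rfl⟩

theorem eA_of_ne {x : τ.Node} {y : (Γ.piece x).Node} (h : y ≠ (Γ.piece x).root) :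
    Γ.extraction.eA (Γ.gmk x y) = 0 := by
  simp [extraction, gmk, h]

theorem eA_base {x : τ.Node} (h : x ≠ τ.root) : Γ.extraction.eA (Γ.gbase x) = Γ.lower x := by
  simp [extraction, h, base]

/-- Edges inside a piece are not boundary edges, so only the edges of `τ` attached at `y`
contribute. -/
theorem piE_mk (x : τ.Node) (y : (Γ.piece x).Node) :
    Γ.extraction.piE (Γ.gmk x y) =
      ∑ v ∈ (τ.children x).filter (fun v => Γ.attach x v = y), Γ.lower v := by
  obtain ⟨h, e⟩ := Γ.children_glue x y
  unfold Extraction.piE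
  rw [e, Finset.sum_disjUnion, Finset.sum_map, Finset.sum_map,
    Finset.sum_eq_zero, zero_add]
  · refine Finset.sum_congr rfl fun v hv => ?_
    exact Γ.eA_base (DecTree.mem_children.mp (Finset.mem_filter.mp hv).1).1
  · intro z hz
    exact Γ.eA_of_ne (DecTree.mem_children.mp hz).1

theorem nA_add_piE (x : τ.Node) (y : (Γ.piece x).Node) :
    Γ.extraction.nA (Γ.gmk x y) + Γ.extraction.piE (Γ.gmk x y) = (Γ.piece x).poly y := by
  rw [piE_mk, ← Γ.poly_eq]
  rfl

/-- The decoration of the piece returns because `𝔫_A` and the lowerings of the edges attached at a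
node add up to it. -/
theorem component_iso (x : τ.Node) :
    (Γ.piece x).Iso (Γ.extraction.component (Γ.gbase x) (Γ.base_not_mem_edges x)) := by
  refine ⟨Equiv.ofBijective (fun y => ⟨Γ.gmk x y, Γ.top_mk x y⟩) ⟨?_, ?_⟩, rfl, ?_, ?_, ?_, ?_⟩
  · intro y z h
    exact eq_of_heq (Sigma.mk.inj (congrArg Subtype.val h)).2
  · rintro ⟨p, hp⟩
    obtain ⟨y, rfl⟩ := (Γ.top_eq_base_iff p x).mp hp
    exact ⟨y, rfl⟩
  · intro y
    apply Subtype.ext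
    by_cases hy : y = (Γ.piece x).root
    · have h : Γ.gmk x y ∉ Γ.extraction.edges := fun h => Γ.mem_edges_iff.mp h hy
      have h2 : (Γ.piece x).parent y = y := by rw [hy, (Γ.piece x).parent_root]
      refine Eq.trans ?_ (congrArg Subtype.val (dif_neg h)).symm
      exact congrArg (fun y => (⟨x, y⟩ : Γ.GNode)) h2
    · have h := Γ.mem_edges_iff.mpr hy
      refine Eq.trans ?_ (congrArg Subtype.val (dif_pos h)).symm
      exact (Γ.gparent_of_ne hy).symm
  · intro y
    exact Γ.nA_add_piE x y
  · intro y
    exact (Γ.piece_ext x y).symm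
  · intro y hy
    exact Γ.gedge_of_ne hy

theorem forest_subset (t : TreeClass d) (ht : t ∈ Γ.extraction.forest) : t ∈ negTrees δ R := by
  obtain ⟨⟨⟨x, y⟩, hn, he⟩, -, rfl⟩ := Multiset.mem_map.mp ht
  have hy : y = (Γ.piece x).root := by
    by_contra h
    exact he (Γ.mem_edges_iff.mpr h)
  subst hy
  have ha : Γ.active x := by
    classical
    exact (Finset.mem_filter.mp hn).2
  have h := Γ.piece_mem x ha
  rwa [show (Γ.piece x).toClass = _ from Quotient.sound (Γ.component_iso x)] at h

/-- Each piece shrinks to its root. What remains of the polynomial decoration is `extra`, with sum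
`τ.poly`; adding `𝔢_A` undoes the lowering of the edge types; and the extended decoration collected
is the degree of the piece. -/
theorem contract_iso : τ.Iso (Γ.extraction.contract δ) := by
  refine ⟨Equiv.ofBijective (fun x => ⟨Γ.gbase x, Γ.base_not_mem_edges x⟩) ⟨?_, ?_⟩, rfl, ?_, ?_,
    ?_, ?_⟩
  · intro x x' h
    exact Γ.base_injective (congrArg Subtype.val h)
  · rintro ⟨⟨x, y⟩, hp⟩
    have hy : y = (Γ.piece x).root := by
      by_contra h
      exact hp (Γ.mem_edges_iff.mpr h)
    subst hy
    exact ⟨x, rfl⟩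
  · intro x
    apply Subtype.ext
    change Γ.base (τ.parent x) = Γ.extraction.top (Γ.gparent (Γ.gbase x))
    by_cases hx : x = τ.root
    · rw [hx, τ.parent_root, gparent_base_root]
      exact (Γ.top_mk τ.root _).symm
    · rw [gparent_base _ hx]
      exact (Γ.top_mk (τ.parent x) _).symm
  · intro x
    change ∑ p ∈ Finset.univ.filter (fun p => Γ.extraction.top p = Γ.gbase x),
      (Γ.glue.poly p - Γ.extraction.nA p) = τ.poly x
    rw [filter_top, Finset.sum_map, ← Γ.sum_extra]
    refine Finset.sum_congr rfl fun y _ => ?_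
    exact add_tsub_cancel_left (Γ.nA x y) (Γ.extra x y)
  · intro x
    change ∑ p ∈ Finset.univ.filter (fun p => Γ.extraction.top p = Γ.gbase x),
      (Γ.glue.ext p + δ.polyDeg (Γ.extraction.nA p + Γ.extraction.piE p)) +
      ∑ p ∈ Γ.extraction.edges.filter (fun p => Γ.extraction.top p = Γ.gbase x),
        δ.edgeDeg (Γ.glue.edge p) = τ.ext x
    rw [filter_top, filter_edges_top, Finset.sum_map, Finset.sum_map, ← Γ.degree_eq,
      DecTree.degree]
    congr 1
    · refine Finset.sum_congr rfl fun y _ => ?_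
      have h : Γ.extraction.nA (Γ.pieceEmb x y) + Γ.extraction.piE (Γ.pieceEmb x y) =
        (Γ.piece x).poly y := Γ.nA_add_piE x y
      rw [h]
      exact zero_add _
    · refine Finset.sum_congr rfl fun y hy => ?_
      exact congrArg δ.edgeDeg (Γ.gedge_of_ne (Finset.mem_filter.mp hy).2)
  · intro x hx
    change ((Γ.gedge (Γ.gbase x)).1, (Γ.gedge (Γ.gbase x)).2 + Γ.extraction.eA (Γ.gbase x)) =
      τ.edge x
    rw [gedge_base, eA_base _ hx]
    exact Prod.ext rfl (tsub_add_cancel_of_le (Γ.lower_le x hx))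

theorem toClass_mem_extTrees (Γ : Gluing δ R τ) : τ.toClass ∈ extTrees δ R :=
  ⟨Γ.glue, Γ.extraction, Γ.conforms_glue, Γ.forest_subset, Quotient.sound Γ.contract_iso.symm⟩

end Gluing

end RegTrees

namespace RegTrees

variable {d : ℕ} {δ : DegreeMap d} {R : Set (Multiset (EdgeType d))}

/-! ### Trees contributing to the renormalised non-linearities -/

namespace DecTree

theorem Iso.outEdges_eq {τ σ : DecTree d} {φ : τ.Node ≃ σ.Node} (h1 : φ τ.root = σ.root)
    (h2 : ∀ v, φ (τ.parent v) = σ.parent (φ v))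
    (h3 : ∀ v, v ≠ τ.root → σ.edge (φ v) = τ.edge v) (x : τ.Node) :
    σ.outEdges (φ x) = τ.outEdges x := by
  have h : σ.children (φ x) = (τ.children x).map φ.toEmbedding := by
    ext v
    obtain ⟨v, rfl⟩ := φ.surjective v
    rw [Finset.mem_map_equiv, mem_children, mem_children, Equiv.symm_apply_apply, ← h2, ← h1]
    simp
  rw [outEdges, h, Finset.map_val, Multiset.map_map]
  exact Multiset.map_congr rfl fun v hv => h3 v (mem_children.mp hv).1

theorem Conforms.of_iso {τ σ : DecTree d} (h : τ.Iso σ) (hτ : τ.Conforms R) : σ.Conforms R := by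
  obtain ⟨φ, h1, h2, -, h4, h5⟩ := h
  constructor
  · intro x
    obtain ⟨x, rfl⟩ := φ.surjective x
    rw [h4, hτ.1]
  · intro x
    obtain ⟨x, rfl⟩ := φ.surjective x
    rw [Iso.outEdges_eq h1 h2 h5]
    exact hτ.2 x

theorem outEdges_of_isNoiseNode {τ : DecTree d} {x : τ.Node} (h : τ.IsNoiseNode x) :
    τ.outEdges x = 0 := by
  have : τ.children x = ∅ := by
    rw [Finset.eq_empty_iff_forall_notMem]
    intro v hv
    exact (τ.noise_leaf x h.1 h.2).1 v (mem_children.mp hv).1 (mem_children.mp hv).2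
  rw [outEdges, this]
  rfl

end DecTree

/-- If contracting an extraction produces a single node, then either the tree has one node, or the
whole tree was extracted. -/
theorem Extraction.of_contract_iso_unit {τ : DecTree d} (P : Extraction τ) {a : ℝ}
    (h : (P.contract δ).Iso (DecTree.unit d a)) :
    (Subsingleton τ.Node ∧ τ.poly τ.root = 0 ∧ τ.ext τ.root = a) ∨
    (τ.toClass ∈ P.forest ∧ ∑ v, τ.ext v + τ.degree δ = a) := by
  obtain ⟨φ, -, -, h3, h4, -⟩ := h
  -- Nodes outside `P.edges` survive the contraction, and the root already is such a node. So all
  -- edges are contracted, which leaves no boundary and hence no `𝔢_A`.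
  have hedge : ∀ v, v ≠ τ.root → v ∈ P.edges := by
    intro v hv
    by_contra hve
    have : (⟨v, hve⟩ : {v // v ∉ P.edges}) = ⟨τ.root, P.root_not_mem⟩ :=
      φ.injective (Subsingleton.elim (α := Unit) _ _)
    exact hv (congrArg Subtype.val this)
  have htop : ∀ v, P.top v = τ.root := by
    intro v
    by_contra hv
    exact P.top_not_mem v (hedge _ hv)
  have hfilter : ∀ s : Finset τ.Node, s.filter (fun v => P.top v = τ.root) = s := fun s =>
    Finset.filter_true_of_mem fun v _ => htop v
  have hpiE : ∀ v, P.piE v = 0 := by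
    intro v
    refine Finset.sum_eq_zero fun w hw => P.eA_support w ?_
    exact fun hc => hc.2.1 (hedge w hc.1)
  have hnA : ∀ v, P.nA v = τ.poly v := by
    have hp : ∑ v ∈ Finset.univ.filter (fun v => P.top v = τ.root), (τ.poly v - P.nA v) = 0 :=
      (h3 ⟨τ.root, P.root_not_mem⟩).symm
    rw [hfilter, Finset.sum_eq_zero_iff] at hp
    exact fun v => le_antisymm (P.nA_le v) (tsub_eq_zero_iff_le.mp (hp v (Finset.mem_univ v)))
  have hext : ∑ v, τ.ext v + τ.degree δ = a := by
    have he : ∑ v ∈ Finset.univ.filter (fun v => P.top v = τ.root),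
        (τ.ext v + δ.polyDeg (P.nA v + P.piE v)) +
      ∑ v ∈ P.edges.filter (fun v => P.top v = τ.root), δ.edgeDeg (τ.edge v) = a :=
      (h4 ⟨τ.root, P.root_not_mem⟩).symm
    have hE : P.edges = Finset.univ.filter (fun v => v ≠ τ.root) := by
      ext v
      simpa using ⟨P.edges_ne_root v, hedge v⟩
    rw [hfilter, hfilter, Finset.sum_add_distrib, add_assoc, hE] at he
    rw [← he, DecTree.degree]
    simp only [hnA, hpiE, add_zero]
  by_cases hroot : τ.root ∈ P.nodes
  · refine Or.inr ⟨?_, hext⟩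
    refine Multiset.mem_map.mpr ⟨⟨τ.root, hroot, P.root_not_mem⟩, Finset.mem_univ _, ?_⟩
    refine Quotient.sound (DecTree.Iso.symm ?_)
    refine ⟨Equiv.ofBijective (fun v => ⟨v, htop v⟩) ⟨fun v w h => congrArg Subtype.val h,
      fun ⟨v, hv⟩ => ⟨v, rfl⟩⟩, rfl, ?_, ?_, fun _ => rfl, fun _ _ => rfl⟩
    · intro v
      by_cases hv : v = τ.root
      · subst hv
        refine Eq.trans ?_ (dif_neg P.root_not_mem).symm
        exact Subtype.ext τ.parent_root
      · exact Eq.symm ((congrArg id (dif_pos (hedge v hv))).trans (Subtype.ext rfl))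
    · intro v
      change P.nA v + P.piE v = τ.poly v
      rw [hnA, hpiE, add_zero]
  · refine Or.inl ?_
    -- Since every edge of the tree lies in `A`, an edge anywhere would put the root into `A`.
    have hall : ∀ v, v = τ.root := by
      have key : ∀ v, v ∉ P.nodes := by
        intro v
        obtain ⟨k, hk⟩ := τ.reaches_root v
        induction k generalizing v with
        | zero =>
          obtain rfl : v = τ.root := hk
          exact hroot
        | succ k ih =>
          intro hv
          by_cases h : v = τ.root
          · exact hroot (h ▸ hv)
          · exact ih (τ.parent v) hk (P.edges_lower v (hedge v h))
      intro v
      by_contra hv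
      exact key v (P.edges_upper v (hedge v hv))
    have hsub : Subsingleton τ.Node := ⟨fun v w => (hall v).trans (hall w).symm⟩
    have hpoly : τ.poly τ.root = 0 := by rw [← hnA, P.nA_support _ hroot]
    refine ⟨hsub, hpoly, ?_⟩
    have hu : (Finset.univ : Finset τ.Node) = {τ.root} := by
      ext v
      simp [hall v]
    rw [← hext, DecTree.degree, hu]
    simp [hpoly, DegreeMap.polyDeg, Finset.filter_singleton]

/-- Distinct trees are orthogonal, so pairing with `𝟏^a` reads off one coefficient of `M_g c`; for
it not to vanish, some extraction must survive the projection and contract to `𝟏^a`. -/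
theorem exists_extraction_of_renormAdj_ne_zero (g : NegChar δ R) (a : ℝ) (c : TreeClass d)
    (h : renormAdj g (Finsupp.single (DecTree.unit d a).toClass 1) c ≠ 0) :
    ∃ P : Extraction (Quotient.out c : DecTree d), P.forest ∈ negForests δ R ∧
      (P.contract δ).Iso (DecTree.unit d a) := by
  have h1 : renorm g (Finsupp.single c 1) (DecTree.unit d a).toClass ≠ 0 := by
    intro h0
    apply h
    unfold renormAdj treeInner
    rw [Finsupp.sum_single_index (by simp), h0]
    simp
  have h2 : renorm g (Finsupp.single c 1) = TensorProduct.lid ℝ (TreeSpace d)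
      (LinearMap.rTensor (TreeSpace d) g.toLinearMap
        (coactTree δ R (Quotient.out c : DecTree d))) := by
    simp [renorm, coaction]
  rw [h2, coactTree] at h1
  by_contra hcon
  apply h1
  refine finsum_induction (fun z => (TensorProduct.lid ℝ (TreeSpace d)
    (LinearMap.rTensor (TreeSpace d) g.toLinearMap z)) (DecTree.unit d a).toClass = 0) ?_ ?_ ?_
  · simp
  · intro x y hx hy
    rw [map_add, map_add, Finsupp.add_apply, hx, hy, add_zero]
  · intro P
    by_cases hP : P.forest ∈ negForests δ R
    · have hne : (P.contract δ).toClass ≠ (DecTree.unit d a).toClass := fun he =>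
        hcon ⟨P, hP, Quotient.exact he⟩
      simp [hne]
    · simp [projNeg, hP]

/-- Polynomial decoration `k`, edges `N` and extended decoration `a` can occur at a node of a tree
obtained by contracting a conforming tree: `σ` is what is contracted to the node. -/
def Admissible (δ : DegreeMap d) (R : Set (Multiset (EdgeType d))) (k : Fin d → ℕ)
    (N : Multiset (EdgeType d)) (a : ℝ) : Prop :=
  ∃ (σ : DecTree d) (active : Prop) (W : Multiset (σ.Node × (Fin d → ℕ) × EdgeType d))
    (nA extra : σ.Node → Fin d → ℕ), IsSpread σ k N W nA extra ∧
    (∀ y, σ.outEdges y + (W.filter fun t => t.1 = y).map (fun t => t.2.2) ∈ R) ∧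
    (active → σ.toClass ∈ negTrees δ R) ∧
    (¬ active → Subsingleton σ.Node ∧ σ.poly σ.root = 0) ∧ (∀ y, σ.ext y = 0) ∧ σ.degree δ = a

theorem IsNormal.zero_mem (hR : IsNormal R) {N : Multiset (EdgeType d)} (hN : N ∈ R) : 0 ∈ R :=
  hR 0 N (Multiset.zero_le N) hN

theorem coe_nodeProd (σ : DecTree d) (F : nonlinearities d)
    (hσ : ∀ y, ¬ σ.IsNoiseNode y → σ.ext y = 0) :
    (nodeProd σ F (fun y => wordOf (σ.poly y)) fun y => (σ.outEdges y).toList : JetFun d) =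
      upsilon (reduced F.1) σ := by
  classical
  unfold nodeProd upsilon
  rw [← Subalgebra.coe_val, map_prod]
  refine Finset.prod_congr rfl fun y hy => ?_
  rw [hσ y (Finset.mem_filter.mp hy).2, reduced, Pi.single_eq_same, Subalgebra.coe_val,
    coe_shiftWord_wordOf, coe_pderivWord]

theorem upsilon_reduced_eq_zero (σ : DecTree d) (F : JetFun d) {y : σ.Node}
    (hy : ¬ σ.IsNoiseNode y) (hne : σ.ext y ≠ 0) : upsilon (reduced F) σ = 0 := by
  classical
  refine Finset.prod_eq_zero (i := y) (by simpa using hy) ?_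
  have h : reduced F (σ.ext y) = (0 : nonlinearities d).1 :=
    Pi.single_eq_of_ne (M := fun _ : ℝ => JetFun d) hne F
  rw [h, ← coe_pderivWord, ← coe_shiftWord_wordOf, map_zero, map_zero]
  rfl

/-- The trees that contribute to `F^g_a`. -/
def contributing (g : NegChar δ R) (a : ℝ) : Set (DecTree d) :=
  {σ | ∃ c : TreeClass d, σ = Quotient.out c ∧
    renormAdj g (Finsupp.single (DecTree.unit d a).toClass 1) c ≠ 0 ∧ ∀ y, σ.ext y = 0}

/-- Trees with an extended decoration at a non-noise node drop out because the family is supported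
at index `0`. A `finsum` is a finite sum or zero, so membership in the span can be checked term by
term. -/
theorem exists_mem_span_act (F : nonlinearities d) (g : NegChar δ R) (a : ℝ) :
    ∃ X ∈ Submodule.span ℝ ((fun σ : DecTree d => nodeProd σ F (fun y => wordOf (σ.poly y))
      fun y => (σ.outEdges y).toList) '' contributing g a), X.1 = act (reduced F.1) g a := by
  unfold act upsilonLin
  refine finsum_induction (fun f => ∃ X ∈ Submodule.span ℝ ((fun σ : DecTree d => nodeProd σ F
    (fun y => wordOf (σ.poly y)) fun y => (σ.outEdges y).toList) '' contributing g a), X.1 = f)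
    ⟨0, Submodule.zero_mem _, rfl⟩ ?_ ?_
  · rintro _ _ ⟨X, hX, rfl⟩ ⟨Y, hY, rfl⟩
    exact ⟨X + Y, Submodule.add_mem _ hX hY, rfl⟩
  · intro c
    by_cases hc : renormAdj g (Finsupp.single (DecTree.unit d a).toClass 1) c = 0
    · exact ⟨0, Submodule.zero_mem _, by rw [hc, zero_smul]; rfl⟩
    by_cases hext : ∀ y, ¬ (Quotient.out c : DecTree d).IsNoiseNode y →
        (Quotient.out c : DecTree d).ext y = 0
    · refine ⟨renormAdj g (Finsupp.single (DecTree.unit d a).toClass 1) c • _,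
        Submodule.smul_mem _ _ (Submodule.subset_span ⟨_, ⟨c, rfl, hc, ?_⟩, rfl⟩), ?_⟩
      · intro y
        by_cases hy : (Quotient.out c : DecTree d).IsNoiseNode y
        · exact ((Quotient.out c : DecTree d).noise_leaf y hy.1 hy.2).2.2
        · exact hext y hy
      · rw [← coe_nodeProd _ _ hext]
        rfl
    · push Not at hext
      obtain ⟨y, hy, hne⟩ := hext
      exact ⟨0, Submodule.zero_mem _, by rw [upsilon_reduced_eq_zero _ _ hy hne, smul_zero]; rfl⟩

theorem admissible_of_contributing (hR : IsNormal R) (F : nonlinearities d) (hF : Obeys F.1 R)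
    {g : NegChar δ R} {a : ℝ} {σ : DecTree d} (hσ : σ ∈ contributing g a) (k : Fin d → ℕ)
    (E : List (EdgeType d))
    (h : shiftWord (wordOf k) (pderivWord E (nodeProd σ F (fun y => wordOf (σ.poly y))
      fun y => (σ.outEdges y).toList)) ≠ 0) : Admissible δ R k E a := by
  obtain ⟨W, nA, extra, hW, hrule⟩ := exists_isSpread σ F hF _ _ h
  rw [wordCount_wordOf] at hW
  obtain ⟨c, rfl, hc, hext⟩ := hσ
  obtain ⟨P, hforest, hiso⟩ := exists_extraction_of_renormAdj_ne_zero g a c hc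
  have hrule' : ∀ y, (Quotient.out c : DecTree d).outEdges y +
      (W.filter fun t => t.1 = y).map (fun t => t.2.2) ∈ R := by
    intro y
    by_cases hy : (Quotient.out c : DecTree d).IsNoiseNode y
    · rw [DecTree.outEdges_of_isNoiseNode hy, Multiset.filter_eq_nil.mpr]
      -- Noise nodes carry no edges, so conformity there amounts to `0 ∈ R`, which normality derives
      -- from the root.
      · exact hR.zero_mem (hrule (Quotient.out c : DecTree d).root fun h => h.1 rfl)
      · rintro t ht rfl
        exact hW.not_noise t ht hy
    · exact hrule y hy
  -- Normality discards the attached edges. Conformity then places the extracted tree, known only to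
  -- be in `negExtTrees`, in `negTrees`.
  have hconf : (Quotient.out c : DecTree d).Conforms R :=
    ⟨hext, fun y => hR _ _ (Multiset.le_add_right _ _) (hrule' y)⟩
  rcases P.of_contract_iso_unit hiso with ⟨hsub, hpoly, ha⟩ | ⟨hmem, ha⟩
  · refine ⟨_, False, W, nA, extra, hW, hrule', False.elim, fun _ => ⟨hsub, hpoly⟩, hext, ?_⟩
    rw [← ha, hext, DecTree.degree, Finset.sum_eq_zero, Finset.filter_false_of_mem]
    · simp
    · intro v _ hv
      exact hv (Subsingleton.elim _ _)
    · intro v _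
      rw [Subsingleton.elim v (Quotient.out c : DecTree d).root, hpoly]
      simp [DegreeMap.polyDeg]
  · refine ⟨_, True, W, nA, extra, hW, hrule', fun _ => ?_, fun h => (h trivial).elim, hext, ?_⟩
    · obtain ⟨τ, hτ, -, h1, h2, h3⟩ := hforest _ hmem
      exact ⟨τ, hτ, hconf.of_iso (Quotient.exact hτ.symm), h1, h2, h3⟩
    · simpa [hext] using ha

theorem admissible_of_ne_zero (hR : IsNormal R) (F : nonlinearities d) (hF : Obeys F.1 R)
    (g : NegChar δ R) (a : ℝ) (k : Fin d → ℕ) (E : List (EdgeType d))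
    (h : shiftDerivs k (pderivs E (act (reduced F.1) g a)) ≠ 0) : Admissible δ R k E a := by
  obtain ⟨X, hX, hXa⟩ := exists_mem_span_act F g a
  by_contra hcon
  apply h
  have hker : X ∈ LinearMap.ker (shiftWord (wordOf k) ∘ₗ pderivWord E) := by
    refine Submodule.span_le.mpr ?_ hX
    rintro _ ⟨σ, hσ, rfl⟩
    by_contra hne
    exact hcon (admissible_of_contributing hR F hF hσ k E hne)
  rw [← hXa, ← coe_pderivWord, ← coe_shiftWord_wordOf]
  exact congrArg Subtype.val (LinearMap.mem_ker.mp hker)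

end RegTrees

namespace RegTrees

variable {d : ℕ} {δ : DegreeMap d} {R : Set (Multiset (EdgeType d))}

/-! ### Trees all of whose nodes are admissible -/

/-- Turns an equality of multisets of edge types into a choice, edge by edge, of the attachment;
edges of equal type may be matched arbitrarily. -/
theorem exists_map_eq_of_map_eq {α β γ : Type*} [Nonempty γ] (f : α → β) (g : γ → β)
    (s : Finset α) (W : Multiset γ) (h : W.map g = s.val.map f) :
    ∃ k : α → γ, (∀ a ∈ s, g (k a) = f a) ∧ W = s.val.map k := by
  classical
  induction s using Finset.induction_on generalizing W with
  | empty =>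
    exact ⟨fun _ => Classical.arbitrary γ, by simp, by simpa using h⟩
  | insert a s ha ih =>
    rw [Finset.insert_val_of_notMem ha, Multiset.map_cons] at h
    obtain ⟨c, hc, hca⟩ := Multiset.mem_map.mp (h ▸ Multiset.mem_cons_self (f a) _)
    obtain ⟨W', rfl⟩ := Multiset.exists_cons_of_mem hc
    rw [Multiset.map_cons, hca, Multiset.cons_inj_right] at h
    obtain ⟨k, hk, hW⟩ := ih W' h
    refine ⟨Function.update k a c, ?_, ?_⟩
    · intro b hb
      by_cases hba : b = a
      · subst hba
        simpa using hca
      · rw [Function.update_of_ne hba]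
        exact hk b ((Finset.mem_insert.mp hb).resolve_left hba)
    · rw [Finset.insert_val_of_notMem ha, Multiset.map_cons, Function.update_self, hW]
      congr 1
      refine Multiset.map_congr rfl fun b hb => ?_
      rw [Function.update_of_ne]
      rintro rfl
      exact ha hb

/-- The tree `σ` that is contracted to the node `x`, with an explicit attachment of the edges
leaving `x`. -/
structure NodeData (δ : DegreeMap d) (R : Set (Multiset (EdgeType d))) (τ : DecTree d)
    (x : τ.Node) where
  piece : DecTree d
  active : Prop
  attach : τ.Node → piece.Node
  lower : τ.Node → Fin d → ℕ
  nA : piece.Node → Fin d → ℕ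
  extra : piece.Node → Fin d → ℕ
  not_active_of_noise : τ.IsNoiseNode x → ¬ active
  subsingleton : ¬ active → Subsingleton piece.Node
  nA_eq_zero : ¬ active → ∀ y, nA y = 0
  lower_eq_zero : ¬ active → ∀ v ∈ τ.children x, lower v = 0
  piece_mem : active → piece.toClass ∈ negTrees δ R
  piece_ext : ∀ y, piece.ext y = 0
  degree_eq : piece.degree δ = τ.ext x
  poly_eq : ∀ y, nA y + ∑ v ∈ (τ.children x).filter (fun v => attach v = y), lower v =
    piece.poly y
  attach_not_noise : ∀ v ∈ τ.children x, ¬ piece.IsNoiseNode (attach v)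
  extra_noise : ∀ y, piece.IsNoiseNode y → extra y = 0
  sum_extra : ∑ y, extra y = τ.poly x
  lower_le : ∀ v ∈ τ.children x, lower v ≤ (τ.edge v).2
  mem_rule : ∀ y, piece.outEdges y + ((τ.children x).filter fun v => attach v = y).val.map
      (fun v => ((τ.edge v).1, (τ.edge v).2 - lower v)) ∈ R

/-- Every edge leaves exactly one node, so the lowerings chosen independently at the nodes combine
into one function, evaluated through the parent. -/
theorem NodeData.toClass_mem_extTrees {τ : DecTree d} (Λ : ∀ x, NodeData δ R τ x) :
    τ.toClass ∈ extTrees δ R := by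
  have hchild : ∀ v, v ≠ τ.root → v ∈ τ.children (τ.parent v) := fun v hv =>
    DecTree.mem_children.mpr ⟨hv, rfl⟩
  have hpar : ∀ x, ∀ v ∈ τ.children x, (Λ (τ.parent v)).lower v = (Λ x).lower v := by
    intro x v hv
    rw [(DecTree.mem_children.mp hv).2]
  refine Gluing.toClass_mem_extTrees
    { piece := fun x => (Λ x).piece
      active := fun x => (Λ x).active
      attach := fun x => (Λ x).attach
      lower := fun v => (Λ (τ.parent v)).lower v
      nA := fun x => (Λ x).nA
      extra := fun x => (Λ x).extra
      not_active_of_noise := fun x => (Λ x).not_active_of_noise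
      subsingleton := fun x => (Λ x).subsingleton
      nA_eq_zero := fun x => (Λ x).nA_eq_zero
      lower_eq_zero := fun v hv h => (Λ (τ.parent v)).lower_eq_zero h v (hchild v hv)
      piece_mem := fun x => (Λ x).piece_mem
      piece_ext := fun x => (Λ x).piece_ext
      degree_eq := fun x => (Λ x).degree_eq
      poly_eq := fun x y => ?_
      attach_not_noise := fun x => (Λ x).attach_not_noise
      extra_noise := fun x => (Λ x).extra_noise
      sum_extra := fun x => (Λ x).sum_extra
      lower_le := fun v hv => (Λ (τ.parent v)).lower_le v (hchild v hv)
      mem_rule := fun x y => ?_ }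
  · rw [← (Λ x).poly_eq]
    congr 1
    exact Finset.sum_congr rfl fun v hv => hpar x v (Finset.mem_filter.mp hv).1
  · convert (Λ x).mem_rule y using 2
    refine Multiset.map_congr rfl fun v hv => ?_
    rw [hpar x v (Finset.mem_filter.mp hv).1]

theorem degree_unit (a : ℝ) : (DecTree.unit d a).degree δ = 0 := by
  have h : (Finset.univ.filter fun v => v ≠ (DecTree.unit d a).root) = ∅ :=
    Finset.filter_false_of_mem fun v _ hv => hv rfl
  rw [DecTree.degree, h, Finset.sum_empty, add_zero]
  simp [DecTree.unit, DegreeMap.polyDeg]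

theorem outEdges_unit (a : ℝ) (y : (DecTree.unit d a).Node) :
    (DecTree.unit d a).outEdges y = 0 := by
  have h : (DecTree.unit d a).children y = ∅ :=
    Finset.filter_false_of_mem fun v _ hv => hv.1 rfl
  rw [DecTree.outEdges, h]
  rfl

theorem nonempty_nodeData_of_isNoiseNode (hR : 0 ∈ R) {τ : DecTree d} {x : τ.Node}
    (hx : τ.IsNoiseNode x) : Nonempty (NodeData δ R τ x) := by
  obtain ⟨h1, h2, h3⟩ := τ.noise_leaf x hx.1 hx.2
  have hc : τ.children x = ∅ := by
    rw [Finset.eq_empty_iff_forall_notMem]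
    exact fun v hv => h1 v (DecTree.mem_children.mp hv).1 (DecTree.mem_children.mp hv).2
  exact ⟨
    { piece := DecTree.unit d 0
      active := False
      attach := fun _ => (DecTree.unit d 0).root
      lower := fun _ => 0
      nA := fun _ => 0
      extra := fun _ => 0
      not_active_of_noise := fun _ => id
      subsingleton := fun _ => inferInstanceAs (Subsingleton Unit)
      nA_eq_zero := fun _ _ => rfl
      lower_eq_zero := fun _ _ _ => rfl
      piece_mem := False.elim
      piece_ext := fun _ => rfl
      degree_eq := by rw [degree_unit, h3]
      poly_eq := fun y => by simp [hc]; rfl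
      attach_not_noise := by simp [hc]
      extra_noise := fun _ _ => rfl
      sum_extra := by simp [h2]
      lower_le := by simp [hc]
      mem_rule := fun y => by simpa [hc, outEdges_unit] using hR }⟩

theorem Admissible.nonempty_nodeData {τ : DecTree d} {x : τ.Node} (hx : ¬ τ.IsNoiseNode x)
    (h : Admissible δ R (τ.poly x) (τ.outEdges x) (τ.ext x)) : Nonempty (NodeData δ R τ x) := by
  obtain ⟨σ, active, W, nA, extra, hW, hrule, hact, hnact, hext, hdeg⟩ := h
  have : Nonempty (σ.Node × (Fin d → ℕ) × EdgeType d) := ⟨(σ.root, 0, (EdgeKind.kernel, 0))⟩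
  obtain ⟨κ, hκ, rfl⟩ := exists_map_eq_of_map_eq τ.edge _ (τ.children x) W hW.map_eq
  have hfilter : ∀ y, ((τ.children x).val.map κ).filter (fun t => t.1 = y) =
      ((τ.children x).filter fun v => (κ v).1 = y).val.map κ := by
    intro y
    rw [Multiset.filter_map]
    rfl
  have hpoly : ∀ y, nA y + ∑ v ∈ (τ.children x).filter (fun v => (κ v).1 = y), (κ v).2.1 =
      σ.poly y := by
    intro y
    rw [← hW.poly_eq, hfilter, Multiset.map_map]
    rfl
  -- A piece that is not extracted is one node without decoration, so no edge attached to it can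
  -- have been lowered.
  have hzero : ¬ active → ∀ y, nA y = 0 ∧
      ∑ v ∈ (τ.children x).filter (fun v => (κ v).1 = y), (κ v).2.1 = 0 := by
    intro hna y
    obtain ⟨hs, h0⟩ := hnact hna
    have h1 := hpoly y
    rw [Subsingleton.elim y σ.root, h0] at h1
    rw [Subsingleton.elim y σ.root]
    exact add_eq_zero.mp h1
  exact ⟨
    { piece := σ
      active := active
      attach := fun v => (κ v).1
      lower := fun v => (κ v).2.1
      nA := nA
      extra := extra
      not_active_of_noise := fun h => (hx h).elim
      subsingleton := fun h => (hnact h).1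
      nA_eq_zero := fun h y => (hzero h y).1
      lower_eq_zero := fun h v hv => Finset.sum_eq_zero_iff.mp (hzero h (κ v).1).2 v
        (Finset.mem_filter.mpr ⟨hv, rfl⟩)
      piece_mem := hact
      piece_ext := hext
      degree_eq := hdeg
      poly_eq := hpoly
      attach_not_noise := fun v hv => hW.not_noise _ (Multiset.mem_map_of_mem κ hv)
      extra_noise := hW.extra_noise
      sum_extra := hW.sum_extra
      lower_le := fun v hv => by
        rw [← hκ v hv]
        exact le_add_self
      mem_rule := fun y => by
        have h := hrule y
        rw [hfilter, Multiset.map_map] at h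
        convert h using 2
        refine Multiset.map_congr rfl fun v hv => ?_
        rw [← hκ v (Finset.mem_filter.mp hv).1]
        exact Prod.ext rfl (add_tsub_cancel_right _ _) }⟩

theorem Admissible.zero_mem (hR : IsNormal R) {k : Fin d → ℕ} {N : Multiset (EdgeType d)} {a : ℝ}
    (h : Admissible δ R k N a) : 0 ∈ R := by
  obtain ⟨σ, _, _, _, _, _, hrule, _⟩ := h
  exact hR.zero_mem (hrule σ.root)

/-- A tree belongs to `𝔗_∘^ex` if all its non-noise nodes are admissible. -/
theorem toClass_mem_extTrees_of_admissible (hR : IsNormal R) {τ : DecTree d}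
    (h : ∀ x, ¬ τ.IsNoiseNode x → Admissible δ R (τ.poly x) (τ.outEdges x) (τ.ext x)) :
    τ.toClass ∈ extTrees δ R := by
  have hroot : ¬ τ.IsNoiseNode τ.root := fun hn => hn.1 rfl
  have h0 := (h τ.root hroot).zero_mem hR
  have hΛ : ∀ x, Nonempty (NodeData δ R τ x) := by
    intro x
    by_cases hx : τ.IsNoiseNode x
    · exact nonempty_nodeData_of_isNoiseNode h0 hx
    · exact (h x hx).nonempty_nodeData hx
  exact NodeData.toClass_mem_extTrees fun x => (hΛ x).some

/-- Covers the undecorated leaves of a corolla; nothing is extracted there. -/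
theorem admissible_zero (hR : 0 ∈ R) : Admissible δ R 0 0 0 :=
  ⟨DecTree.unit d 0, False, 0, 0, 0,
    { not_noise := by simp
      extra_noise := fun _ _ => rfl
      map_eq := by simp
      sum_extra := by simp
      poly_eq := fun _ => by simp; rfl },
    fun y => by simpa [outEdges_unit] using hR, False.elim,
    fun _ => ⟨inferInstanceAs (Subsingleton Unit), rfl⟩, fun _ => rfl, degree_unit 0⟩

/-! ### Corollas and the extended rule -/

/-- The tree whose root has extended decoration `a` and carries the edges `O`, without any other
edges or decorations. -/
def corolla (a : ℝ) (O : List (EdgeType d)) : DecTree d where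
  Node := Option (Fin O.length)
  fintypeNode := inferInstance
  root := none
  parent := fun _ => none
  parent_root := rfl
  reaches_root := fun _ => ⟨1, rfl⟩
  poly := fun _ => 0
  ext := fun v => v.elim a fun _ => 0
  edge := fun v => v.elim (EdgeKind.kernel, 0) O.get
  noise_leaf := by
    rintro (_ | v) hv _
    · exact absurd rfl hv
    · exact ⟨fun _ _ h => (nomatch h), rfl, rfl⟩

/-- The leaves of a corolla. -/
def corollaLeaf (a : ℝ) (O : List (EdgeType d)) : Fin O.length ↪ (corolla a O).Node :=
  ⟨fun j => (some j : Option (Fin O.length)), Option.some_injective _⟩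

theorem children_corolla_root (a : ℝ) (O : List (EdgeType d)) :
    (corolla a O).children (corolla a O).root = Finset.univ.map (corollaLeaf a O) := by
  ext v
  rw [DecTree.mem_children, Finset.mem_map]
  cases v with
  | none => exact ⟨fun h => absurd rfl h.1, by rintro ⟨_, _, h⟩; cases h⟩
  | some j => exact ⟨fun _ => ⟨j, Finset.mem_univ j, rfl⟩, fun _ => ⟨nofun, rfl⟩⟩

theorem outEdges_corolla_root (a : ℝ) (O : List (EdgeType d)) :
    (corolla a O).outEdges (corolla a O).root = O := by
  rw [DecTree.outEdges, children_corolla_root, Finset.map_val, Multiset.map_map]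
  change Multiset.map O.get Finset.univ.val = O
  rw [Fin.univ_val_map, List.ofFn_get]

theorem outEdges_corolla_leaf (a : ℝ) (O : List (EdgeType d)) (j : Fin O.length) :
    (corolla a O).outEdges (corollaLeaf a O j) = 0 := by
  have h : (corolla a O).children (corollaLeaf a O j) = ∅ :=
    Finset.filter_false_of_mem fun v _ hv => nomatch hv.2
  rw [DecTree.outEdges, h]
  rfl

/-- The corolla is the simplest witness for the extended rule: admissibility is a genuine condition
only at its root. -/
theorem mem_extRule_of_admissible (hR : IsNormal R) {a : ℝ} {O : List (EdgeType d)}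
    (h : Admissible δ R 0 O a) : (O : Multiset (EdgeType d)) ∈ extRule δ R a := by
  refine ⟨corolla a O, toClass_mem_extTrees_of_admissible hR fun x _ => ?_, rfl,
    outEdges_corolla_root a O⟩
  cases x with
  | none => exact (outEdges_corolla_root a O).symm ▸ h
  | some j => exact (outEdges_corolla_leaf a O j).symm ▸ admissible_zero (h.zero_mem hR)

end RegTrees

end

/-! ### The two claims of the proposition -/

theorem mainTheorem10 {d : ℕ} (δ : RegTrees.DegreeMap d)
    (R : Set (Multiset (RegTrees.EdgeType d)))
    (hnormal : RegTrees.IsNormal R) (hsub : RegTrees.IsSubcritical δ R)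
    (F : RegTrees.JetFun d) (hF : RegTrees.IsNonlinearity F) (hobey : RegTrees.Obeys F R)
    (FF : ℝ → RegTrees.JetFun d) (hFF : FF ∈ RegTrees.orbit δ R F) :
    (∀ (a : ℝ) (O : List (RegTrees.EdgeType d)),
      (O : Multiset (RegTrees.EdgeType d)) ∉ RegTrees.extRule δ R a →
        RegTrees.pderivs O (FF a) = 0) ∧
    ∀ τ : RegTrees.DecTree d, τ.toClass ∉ RegTrees.extTrees δ R →
      RegTrees.upsilon FF τ = 0 := by
  obtain ⟨g, rfl⟩ := hFF
  refine ⟨fun a O hO => ?_, fun τ hτ => ?_⟩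
  · by_contra hne
    refine hO (RegTrees.mem_extRule_of_admissible hnormal
      (RegTrees.admissible_of_ne_zero hnormal ⟨F, hF⟩ hobey g a 0 O ?_))
    -- The first claim is the case `k = 0` of the local statement, where `∂^k` is the identity.
    have h0 : ∀ G : RegTrees.JetFun d, RegTrees.shiftDerivs 0 G = G := by
      intro G
      unfold RegTrees.shiftDerivs
      induction List.finRange d with
      | nil => rfl
      | cons i l ih => rw [List.foldr_cons, ih]; rfl
    rw [h0]
    exact hne
  · by_contra hne
    refine hτ (RegTrees.toClass_mem_extTrees_of_admissible hnormal fun x hx => ?_)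
    rw [← Multiset.coe_toList (τ.outEdges x)]
    -- `Υ[τ]` is a product over the non-noise nodes; if it does not vanish, neither does the factor
    -- of `x`, which is the hypothesis of the local statement.
    refine RegTrees.admissible_of_ne_zero hnormal ⟨F, hF⟩ hobey g _ _ _ fun h => hne ?_
    classical
    exact Finset.prod_eq_zero (i := x) (by simpa using hx) h
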